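/- **Setting.** A signature $\Sigma$ consists of a set $B$ of base types, a set $K$ of effect-free constants, a set $O$ of algebraic operations, and, for each $s \in K \cup O$, an arity $\mathrm{ar}(s)$ and a coarity $\mathrm{car}(s)$, both ground types. Here types are $\rho,\tau ::= b \mid 1 \mid \rho\times\tau \mid 0 \mid \rho+\tau \mid \rho\to\tau$ with $b \in B$, and ground types are the types without $\to$. *Source language* (the $\lambda_c$-calculus, without recursion). Terms are $M,N ::= x \mid c\,M \mid o_\rho\,M \mid () \mid (M,N) \mid \pi_i M \mid \delta(M) \mid \iota_i M \mid \delta(M, x_1.N_1, x_2.N_2) \mid \lambda x.M \mid M\,N$ with the usual simple typing rules, where $\Gamma\vdash c\,M:\mathrm{car}(c)$ if $\Gamma\vdash M:\mathrm{ar}(c)$, and $\Gamma\vdash o_\rho\,M:\rho$ if $\Gamma\vdash M:(\mathrm{ar}(o)\to\rho)\times\mathrm{car}(o)$. *Target language.* Types are $\rho,\tau ::= R \mid b \mid 1 \mid \rho\times\tau \mid 0 \mid \rho+\tau \mid \rho\to R$, where $R$ is the answer type. Terms are as above with $o\,M$ in place of $o_\rho\,M$. They are typed as in the simply typed lambda calculus,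 except that case analyses $\delta(M)$ and $\delta(M,x_1.N_1,x_2.N_2)$ (with their branches), bodies of abstractions and results of applications have type $R$, and $\Gamma\vdash o\,M:R$ if $\Gamma\vdash M:(\mathrm{ar}(o)\to R)\times\mathrm{car}(o)$. *CPS transformation.* On types, $(-)^{\mathrm{CPS}}$ fixes $b,1,0$, commutes with $\times$ and $+$, and $(\rho\to\tau)^{\mathrm{CPS}}=(\rho^{\mathrm{CPS}}\times(\tau^{\mathrm{CPS}}\to R))\to R$; so $\rho^{\mathrm{CPS}}=\rho$ for ground $\rho$. It is applied to contexts pointwise. A term $\Gamma\vdash M:\rho$ is sent to $\Gamma^{\mathrm{CPS}}\vdash M^{\mathrm{CPS}}:(\rho^{\mathrm{CPS}}\to R)\to R$, where, with $\lambda(x,y).M$ standing for $\lambda z.M[\pi_1z/x,\pi_2z/y]$, $$\begin{aligned} x^{\mathrm{CPS}}&=\lambda k.\,k\,x, \qquad ()^{\mathrm{CPS}}=\lambda k.\,k\,(),\\ (c\,M)^{\mathrm{CPS}}&=\lambda k.\,M^{\mathrm{CPS}}(\lambda m.\,k\,(c\,m)),\\ (o_\rho\,M)^{\mathrm{CPS}}&=\lambda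 k.\,M^{\mathrm{CPS}}(\lambda(m_1,m_2).\,o\,(\lambda x.\,m_1(x,k),\,m_2)),\\ (M,N)^{\mathrm{CPS}}&=\lambda k.\,M^{\mathrm{CPS}}(\lambda m.\,N^{\mathrm{CPS}}(\lambda n.\,k\,(m,n))),\\ (\pi_iM)^{\mathrm{CPS}}&=\lambda k.\,M^{\mathrm{CPS}}(\lambda m.\,k\,(\pi_im)), \qquad (\iota_iM)^{\mathrm{CPS}}=\lambda k.\,M^{\mathrm{CPS}}(\lambda m.\,k\,(\iota_im)),\\ \delta(M)^{\mathrm{CPS}}&=\lambda k.\,M^{\mathrm{CPS}}(\lambda m.\,\delta(m)),\\ \delta(M,x_1.N_1,x_2.N_2)^{\mathrm{CPS}}&=\lambda k.\,M^{\mathrm{CPS}}(\lambda m.\,\delta(m,x_1.N_1^{\mathrm{CPS}}k,\,x_2.N_2^{\mathrm{CPS}}k)),\\ (\lambda x.M)^{\mathrm{CPS}}&=\lambda k.\,k\,(\lambda(x,h).\,M^{\mathrm{CPS}}h),\\ (M\,N)^{\mathrm{CPS}}&=\lambda k.\,M^{\mathrm{CPS}}(\lambda m.\,N^{\mathrm{CPS}}(\lambda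 n.\,m\,(n,k))). \end{aligned}$$ *Semantics.* Let $\mathcal C$ be a bicartesian closed category (finite products, exponentials $X\Rightarrow Y$ with currying $\Lambda$ and evaluation $\mathbf{ev}$, initial object, binary coproducts), $T$ a strong monad on $\mathcal C$ with unit $\eta$, multiplication $\mu$ and strength $\mathrm{st}_{X,Y}:X\times TY\to T(X\times Y)$. A $(D,E)$-ary algebraic operation for $T$ is a natural transformation $o_X:(D\Rightarrow TX)\to(E\Rightarrow TX)$ with $o_X\circ(D\Rightarrow\mu_X)=(E\Rightarrow\mu_X)\circ o_{TX}$ and $o_{X\times Y}\circ(D\Rightarrow\mathrm{st}_{X,Y})\circ p^D=(E\Rightarrow\mathrm{st}_{X,Y})\circ p^E\circ(X\times o_Y)$, where $p^D:X\times(D\Rightarrow TY)\to(D\Rightarrow X\times TY)$ is the canonical morphism. Its generic effect $\mathrm{gef}(o):E\to TD$ is $\Lambda^{-1}(o_D)$ applied in its first argument to the global element of $D\Rightarrow TD$ that names $\eta_D$. A $\lambda_c(\Sigma)$-structure $\mathcal A=(\mathcal C,T,A,a)$ consists of such $\mathcal C$ and $T$, an object $A(b)$ for each $b\in B$, a morphism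 $a(c):\mathcal A[\![\mathrm{ar}(c)]\!]\to\mathcal A[\![\mathrm{car}(c)]\!]$ for each $c\in K$, and an $(\mathcal A[\![\mathrm{ar}(o)]\!],\mathcal A[\![\mathrm{car}(o)]\!])$-ary algebraic operation $a(o)$ for each $o\in O$. Here $\mathcal A[\![-]\!]$ interprets types by the bicartesian closed structure with $\mathcal A[\![\rho\to\tau]\!]=\mathcal A[\![\rho]\!]\Rightarrow T\mathcal A[\![\tau]\!]$, contexts by products, and source terms $\Gamma\vdash M:\rho$ by the standard left-to-right call-by-value semantics $\mathcal A[\![M]\!]:\mathcal A[\![\Gamma]\!]\to T\mathcal A[\![\rho]\!]$, with $\mathcal A[\![c\,M]\!]=T(a(c))\circ\mathcal A[\![M]\!]$ and $\mathcal A[\![o_\rho M]\!]=\mu\circ T(\Lambda^{-1}(a(o)_{\mathcal A[\![\rho]\!]}))\circ\mathcal A[\![M]\!]$. Let $\nu:T\Omega\to\Omega$ be an Eilenberg–Moore $T$-algebra. The target language is interpreted in $\mathcal C$ as the simply typed lambda calculus, $\mathcal A^\nu[\![M]\!]:\mathcal A^\nu[\![\Gamma]\!]\to\mathcal A^\nu[\![\rho]\!]$,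 with $\mathcal A^\nu[\![b]\!]=A(b)$, $\mathcal A^\nu[\![R]\!]=\Omega$, $\mathcal A^\nu[\![c\,M]\!]=a(c)\circ\mathcal A^\nu[\![M]\!]$ and $\mathcal A^\nu[\![o\,M]\!]=\nu\circ T\mathbf{ev}\circ\mathrm{st}\circ(\mathrm{id}\times\mathrm{gef}(a(o)))\circ\mathcal A^\nu[\![M]\!]$. On ground types $\mathcal A[\![\rho]\!]=\mathcal A^\nu[\![\rho]\!]$. For $f:X\to TY$ and $q:Y\to\Omega$ put $\mathrm{wp}[f](q)=\nu\circ Tq\circ f$. **Theorem.** Assume that for every effect-free constant $c\in K$ the coarity $\mathrm{car}(c)$ is built from base types using only $1$ and $\times$. Let $\mathcal A=(\mathcal C,T,A,a)$ be a $\lambda_c(\Sigma)$-structure, $\nu:T\Omega\to\Omega$ an Eilenberg–Moore $T$-algebra, and $x_1:\rho_1,\dots,x_n:\rho_n\vdash M:\rho$ a well-typed source term with $\rho_1,\dots,\rho_n,\rho$ ground types. Then for every term $x:\rho\vdash P:R$ of the target language, $$\mathrm{wp}\bigl[\mathcal A[\![M]\!]\bigr]\bigl(\mathcal A^\nu[\![P]\!]\bigr)=\mathcal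 A^\nu[\![M^{\mathrm{CPS}}\,(\lambda x:\rho.\,P)]\!].$$ -/

import Mathlib

universe a b c v u

open CategoryTheory Limits MonoidalCategory CartesianMonoidalCategory

namespace LambdaC

/-! ## Syntax of the computational lambda calculus -/

/-- Types of the computational lambda calculus over a set `B` of base types. -/
inductive Ty (B : Type a) : Type a
  | base : B → Ty B
  | unit : Ty B
  | prod : Ty B → Ty B → Ty B
  | zero : Ty B
  | sum : Ty B → Ty B → Ty B
  | arr : Ty B → Ty B → Ty B

/-- Ground types: the types without function types. -/
def Ty.IsGround {B : Type a} : Ty B → Prop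
  | .base _ => True
  | .unit => True
  | .prod ρ τ => ρ.IsGround ∧ τ.IsGround
  | .zero => True
  | .sum ρ τ => ρ.IsGround ∧ τ.IsGround
  | .arr _ _ => False

/-- Product-only ground types: built from base types using only finite products. -/
def Ty.IsProdGround {B : Type a} : Ty B → Prop
  | .base _ => True
  | .unit => True
  | .prod ρ τ => ρ.IsProdGround ∧ τ.IsProdGround
  | .zero => False
  | .sum _ _ => False
  | .arr _ _ => False

/-- Signatures: base types `B`, effect-free constants `K`, algebraic operations `O`, and a ground
arity and a ground coarity for each constant and each operation. -/
structure Sig where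
  B : Type a
  K : Type b
  O : Type c
  arK : K → Ty B
  carK : K → Ty B
  arO : O → Ty B
  carO : O → Ty B
  arK_ground : ∀ k, (arK k).IsGround
  carK_ground : ∀ k, (carK k).IsGround
  arO_ground : ∀ o, (arO o).IsGround
  carO_ground : ∀ o, (carO o).IsGround

/-- Typed de Bruijn variables. A context is a list of types, whose head is the type of the variable
bound last. -/
inductive Var {α : Type a} : List α → α → Type a
  | z {Γ : List α} {ρ : α} : Var (ρ :: Γ) ρ
  | s {Γ : List α} {ρ σ : α} : Var Γ ρ → Var (σ :: Γ) ρ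

/-- The image of a variable when a function is applied to all types of the context. -/
def Var.map {α : Type a} {β : Type b} (f : α → β) {Γ : List α} {ρ : α} :
    Var Γ ρ → Var (Γ.map f) (f ρ)
  | .z => .z
  | .s x => .s (x.map f)

/-- Renamings of variables. -/
abbrev Ren {α : Type a} (Γ Δ : List α) : Type a := ∀ ρ : α, Var Γ ρ → Var Δ ρ

/-- Extension of a renaming under a binder. -/
def Ren.lift {α : Type a} {Γ Δ : List α} (r : Ren Γ Δ) (σ : α) : Ren (σ :: Γ) (σ :: Δ)
  | _, .z => .z
  | _, .s x => .s (r _ x)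

/-- Well-typed terms `Γ ⊢ M : ρ` of the computational lambda calculus (typing derivations, up to
renaming of bound variables). -/
inductive Tm (S : Sig.{a, b, c}) : List (Ty S.B) → Ty S.B → Type (max a b c)
  | var {Γ ρ} : Var Γ ρ → Tm S Γ ρ
  | const {Γ} (k : S.K) : Tm S Γ (S.arK k) → Tm S Γ (S.carK k)
  | op {Γ} (o : S.O) (ρ : Ty S.B) :
      Tm S Γ (.prod (.arr (S.arO o) ρ) (S.carO o)) → Tm S Γ ρ
  | unit {Γ} : Tm S Γ .unit
  | pair {Γ ρ τ} : Tm S Γ ρ → Tm S Γ τ → Tm S Γ (.prod ρ τ)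
  | fst {Γ ρ τ} : Tm S Γ (.prod ρ τ) → Tm S Γ ρ
  | snd {Γ ρ τ} : Tm S Γ (.prod ρ τ) → Tm S Γ τ
  | absurd {Γ ρ} : Tm S Γ .zero → Tm S Γ ρ
  | inl {Γ ρ τ} : Tm S Γ ρ → Tm S Γ (.sum ρ τ)
  | inr {Γ ρ τ} : Tm S Γ τ → Tm S Γ (.sum ρ τ)
  | case {Γ ρ₁ ρ₂ τ} : Tm S Γ (.sum ρ₁ ρ₂) → Tm S (ρ₁ :: Γ) τ → Tm S (ρ₂ :: Γ) τ → Tm S Γ τ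
  | lam {Γ ρ τ} : Tm S (ρ :: Γ) τ → Tm S Γ (.arr ρ τ)
  | app {Γ ρ τ} : Tm S Γ (.arr ρ τ) → Tm S Γ ρ → Tm S Γ τ

/-! ## Syntax of the target language -/

/-- Types of the target language: `R` is the answer type, and `neg ρ` is the type `ρ → R`. -/
inductive TTy (B : Type a) : Type a
  | R : TTy B
  | base : B → TTy B
  | unit : TTy B
  | prod : TTy B → TTy B → TTy B
  | zero : TTy B
  | sum : TTy B → TTy B → TTy B
  | neg : TTy B → TTy B

/-- The CPS transformation on types. By the first five clauses it leaves every ground type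
unchanged, so that on ground types it is just the inclusion of the ground types into the types of
the target language. -/
def Ty.cps {B : Type a} : Ty B → TTy B
  | .base x => .base x
  | .unit => .unit
  | .zero => .zero
  | .prod ρ τ => .prod ρ.cps τ.cps
  | .sum ρ τ => .sum ρ.cps τ.cps
  | .arr ρ τ => .neg (.prod ρ.cps (.neg τ.cps))

/-- Well-typed terms `Γ ⊢ M : ρ` of the target language. Case analyses, bodies of abstractions and
results of applications are restricted to the answer type `R`. The arities and coarities are ground,
and `cps` occurs in the rules for constants and modal operators only as the inclusion of ground
types into the types of the target language. -/
inductive TTm (S : Sig.{a, b, c}) : List (TTy S.B) → TTy S.B → Type (max a b c)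
  | var {Γ ρ} : Var Γ ρ → TTm S Γ ρ
  | const {Γ} (k : S.K) : TTm S Γ (S.arK k).cps → TTm S Γ (S.carK k).cps
  | op {Γ} (o : S.O) : TTm S Γ (.prod (.neg (S.arO o).cps) (S.carO o).cps) → TTm S Γ .R
  | unit {Γ} : TTm S Γ .unit
  | pair {Γ ρ τ} : TTm S Γ ρ → TTm S Γ τ → TTm S Γ (.prod ρ τ)
  | fst {Γ ρ τ} : TTm S Γ (.prod ρ τ) → TTm S Γ ρ
  | snd {Γ ρ τ} : TTm S Γ (.prod ρ τ) → TTm S Γ τ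
  | absurd {Γ} : TTm S Γ .zero → TTm S Γ .R
  | inl {Γ ρ τ} : TTm S Γ ρ → TTm S Γ (.sum ρ τ)
  | inr {Γ ρ τ} : TTm S Γ τ → TTm S Γ (.sum ρ τ)
  | case {Γ ρ₁ ρ₂} :
      TTm S Γ (.sum ρ₁ ρ₂) → TTm S (ρ₁ :: Γ) .R → TTm S (ρ₂ :: Γ) .R → TTm S Γ .R
  | lam {Γ ρ} : TTm S (ρ :: Γ) .R → TTm S Γ (.neg ρ)
  | app {Γ ρ} : TTm S Γ (.neg ρ) → TTm S Γ ρ → TTm S Γ .R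

namespace TTm

variable {S : Sig.{a, b, c}}

/-- Renaming of the free variables of a term. -/
def rename {Γ Δ : List (TTy S.B)} {ρ : TTy S.B} (r : Ren Γ Δ) : TTm S Γ ρ → TTm S Δ ρ
  | .var x => .var (r _ x)
  | .const k M => .const k (M.rename r)
  | .op o M => .op o (M.rename r)
  | .unit => .unit
  | .pair M N => .pair (M.rename r) (N.rename r)
  | .fst M => .fst (M.rename r)
  | .snd M => .snd (M.rename r)
  | .absurd M => .absurd (M.rename r)
  | .inl M => .inl (M.rename r)
  | .inr M => .inr (M.rename r)
  | .case M N₁ N₂ => .case (M.rename r) (N₁.rename (r.lift _)) (N₂.rename (r.lift _))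
  | .lam M => .lam (M.rename (r.lift _))
  | .app M N => .app (M.rename r) (N.rename r)

/-- Weakening by one fresh variable. -/
def wk {Γ : List (TTy S.B)} {ρ : TTy S.B} (σ : TTy S.B) (M : TTm S Γ ρ) : TTm S (σ :: Γ) ρ :=
  M.rename (fun _ x => .s x)

/-- Extension of a simultaneous substitution under a binder. -/
def liftSubst {Γ Δ : List (TTy S.B)} (f : ∀ ρ, Var Γ ρ → TTm S Δ ρ) (σ : TTy S.B) :
    ∀ ρ, Var (σ :: Γ) ρ → TTm S (σ :: Δ) ρ
  | _, .z => .var .z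
  | _, .s x => (f _ x).wk σ

/-- Capture-avoiding simultaneous substitution. -/
def subst {Γ Δ : List (TTy S.B)} {ρ : TTy S.B} (f : ∀ ρ, Var Γ ρ → TTm S Δ ρ) :
    TTm S Γ ρ → TTm S Δ ρ
  | .var x => f _ x
  | .const k M => .const k (M.subst f)
  | .op o M => .op o (M.subst f)
  | .unit => .unit
  | .pair M N => .pair (M.subst f) (N.subst f)
  | .fst M => .fst (M.subst f)
  | .snd M => .snd (M.subst f)
  | .absurd M => .absurd (M.subst f)
  | .inl M => .inl (M.subst f)
  | .inr M => .inr (M.subst f)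
  | .case M N₁ N₂ => .case (M.subst f) (N₁.subst (liftSubst f _)) (N₂.subst (liftSubst f _))
  | .lam M => .lam (M.subst (liftSubst f _))
  | .app M N => .app (M.subst f) (N.subst f)

/-- The substitution `[π₁ z / x, π₂ z / y]`. -/
def projSubst {Γ : List (TTy S.B)} {ρ τ : TTy S.B} :
    ∀ σ, Var (τ :: ρ :: Γ) σ → TTm S (.prod ρ τ :: Γ) σ
  | _, .z => .snd (.var .z)
  | _, .s .z => .fst (.var .z)
  | _, .s (.s w) => .var (.s w)

/-- The abstraction `λ (x, y). M`, which abbreviates `λ z. M[π₁ z / x, π₂ z / y]`. -/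
def plam {Γ : List (TTy S.B)} {ρ τ : TTy S.B} (M : TTm S (τ :: ρ :: Γ) .R) :
    TTm S Γ (.neg (.prod ρ τ)) :=
  .lam (M.subst projSubst)

end TTm

/-! ## The CPS transformation on terms -/

/-- The CPS transformation of a term. In the comments, `M^` is the transform of `M`. -/
def Tm.cps {S : Sig.{a, b, c}} {Γ : List (Ty S.B)} {ρ : Ty S.B} :
    Tm S Γ ρ → TTm S (Γ.map Ty.cps) (.neg (.neg ρ.cps))
  -- λ k. k x
  | .var x => .lam (.app (.var .z) (.var (.s (x.map Ty.cps))))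
  -- λ k. M^ (λ m. k (c m))
  | .const k M => .lam (.app (M.cps.wk _) (.lam (.app (.var (.s .z)) (.const k (.var .z)))))
  -- λ k. M^ (λ (m₁, m₂). o (λ x. m₁ (x, k), m₂))
  | .op o _ M => .lam (.app (M.cps.wk _) (.plam (.op o (.pair
      (.lam (.app (.var (.s (.s .z))) (.pair (.var .z) (.var (.s (.s (.s .z)))))))
      (.var .z)))))
  -- λ k. k ()
  | .unit => .lam (.app (.var .z) .unit)
  -- λ k. M^ (λ m. N^ (λ n. k (m, n)))
  | .pair M N => .lam (.app (M.cps.wk _) (.lam (.app ((N.cps.wk _).wk _)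
      (.lam (.app (.var (.s (.s .z))) (.pair (.var (.s .z)) (.var .z)))))))
  -- λ k. M^ (λ m. k (πᵢ m))
  | .fst M => .lam (.app (M.cps.wk _) (.lam (.app (.var (.s .z)) (.fst (.var .z)))))
  | .snd M => .lam (.app (M.cps.wk _) (.lam (.app (.var (.s .z)) (.snd (.var .z)))))
  -- λ k. M^ (λ m. δ(m))
  | .absurd M => .lam (.app (M.cps.wk _) (.lam (.absurd (.var .z))))
  -- λ k. M^ (λ m. k (ιᵢ m))
  | .inl M => .lam (.app (M.cps.wk _) (.lam (.app (.var (.s .z)) (.inl (.var .z)))))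
  | .inr M => .lam (.app (M.cps.wk _) (.lam (.app (.var (.s .z)) (.inr (.var .z)))))
  -- λ k. M^ (λ m. δ(m, x₁. N₁^ k, x₂. N₂^ k))
  | .case M N₁ N₂ => .lam (.app (M.cps.wk _) (.lam (.case (.var .z)
      (.app (N₁.cps.rename (Ren.lift (fun _ x => .s (.s x)) _)) (.var (.s (.s .z))))
      (.app (N₂.cps.rename (Ren.lift (fun _ x => .s (.s x)) _)) (.var (.s (.s .z)))))))
  -- λ k. k (λ (x, h). M^ h)
  | .lam M => .lam (.app (.var .z) (.plam
      (.app ((M.cps.rename (Ren.lift (fun _ x => .s x) _)).wk _) (.var .z))))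
  -- λ k. M^ (λ m. N^ (λ n. m (n, k)))
  | .app M N => .lam (.app (M.cps.wk _) (.lam (.app ((N.cps.wk _).wk _)
      (.lam (.app (.var (.s .z)) (.pair (.var .z) (.var (.s (.s .z)))))))))

/-- The inclusion of the context `x : ρ` into the context `Γ, x : ρ`. -/
def Ren.last {α : Type a} (Γ : List α) (ρ : α) : Ren [ρ] (ρ :: Γ)
  | _, .z => .z

/-- A term `x : ρ ⊢ P : τ` of the target language, weakened to `Γ, x : ρ ⊢ P : τ`. -/
def TTm.weakenCtx {S : Sig.{a, b, c}} {ρ τ : TTy S.B} (Γ : List (TTy S.B)) (P : TTm S [ρ] τ) :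
    TTm S (ρ :: Γ) τ :=
  P.rename (Ren.last Γ ρ)

/-! ## Strong monads and algebraic operations

A bicartesian closed category is a category with chosen finite products, exponentials, an initial
object and binary coproducts. -/

noncomputable section

variable {C : Type u} [Category.{v} C] [CartesianMonoidalCategory C]

/-- The braiding `X × Y → Y × X`. -/
def swap (X Y : C) : X ⊗ Y ⟶ Y ⊗ X := lift (snd X Y) (fst X Y)

/-- Strong monads: monads with a strength compatible with the left unitor, the associator, the unit
and the multiplication. -/
structure StrongMonad (C : Type u) [Category.{v} C] [CartesianMonoidalCategory C]
    extends Monad C where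
  str (X Y : C) : X ⊗ toFunctor.obj Y ⟶ toFunctor.obj (X ⊗ Y)
  str_natural {X X' Y Y' : C} (f : X ⟶ X') (g : Y ⟶ Y') :
    (f ⊗ₘ toFunctor.map g) ≫ str X' Y' = str X Y ≫ toFunctor.map (f ⊗ₘ g)
  str_leftUnitor (Y : C) :
    str (𝟙_ C) Y ≫ toFunctor.map (λ_ Y).hom = (λ_ (toFunctor.obj Y)).hom
  str_associator (X Y Z : C) :
    str (X ⊗ Y) Z ≫ toFunctor.map (α_ X Y Z).hom =
      (α_ X Y (toFunctor.obj Z)).hom ≫ (X ◁ str Y Z) ≫ str X (Y ⊗ Z)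
  str_unit (X Y : C) : (X ◁ η.app Y) ≫ str X Y = η.app (X ⊗ Y)
  str_mul (X Y : C) :
    (X ◁ μ.app Y) ≫ str X Y = str X (toFunctor.obj Y) ≫ toFunctor.map (str X Y) ≫ μ.app (X ⊗ Y)

/-- The weakest precondition transformer `wp[f](q) = ν ∘ T q ∘ f` of an Eilenberg-Moore algebra
`ν : T Ω → Ω`. -/
def wp {T : StrongMonad C} (ν : T.toMonad.Algebra) {X Y : C} (f : X ⟶ T.obj Y) (q : Y ⟶ ν.A) :
    X ⟶ ν.A :=
  f ≫ T.map q ≫ ν.a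

/-- The interpretation of a context as a product, given the interpretation of types. -/
def ctxObj {α : Type a} (f : α → C) : List α → C
  | [] => 𝟙_ C
  | ρ :: Γ => ctxObj f Γ ⊗ f ρ

/-- The interpretation of a variable as a projection. -/
def Var.proj {α : Type a} (f : α → C) {Γ : List α} {ρ : α} : Var Γ ρ → (ctxObj f Γ ⟶ f ρ)
  | .z => snd _ _
  | .s x => fst _ _ ≫ x.proj f

variable [MonoidalClosed C]

/-- The transpose `X → (Y ⇒ Z)` of a morphism `X × Y → Z`. -/
def Lam {X Y Z : C} (f : X ⊗ Y ⟶ Z) : X ⟶ (ihom Y).obj Z :=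
  MonoidalClosed.curry (swap Y X ≫ f)

/-- The evaluation `(Y ⇒ Z) × Y → Z`. -/
def Ev (Y Z : C) : (ihom Y).obj Z ⊗ Y ⟶ Z :=
  swap _ _ ≫ (ihom.ev Y).app Z

/-- The inverse transpose `X × Y → Z` of a morphism `X → (Y ⇒ Z)`. -/
def Unlam {X Y Z : C} (g : X ⟶ (ihom Y).obj Z) : X ⊗ Y ⟶ Z :=
  (g ▷ Y) ≫ Ev Y Z

/-- The canonical morphism `X × (D ⇒ Z) → (D ⇒ X × Z)`. -/
def push (D X Z : C) : X ⊗ (ihom D).obj Z ⟶ (ihom D).obj (X ⊗ Z) :=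
  Lam ((α_ X ((ihom D).obj Z) D).hom ≫ (X ◁ Ev D Z))

/-- `(D, E)`-ary algebraic operations: natural transformations `(D ⇒ T X) → (E ⇒ T X)` compatible
with the strength and the multiplication of `T`. -/
structure AlgOp (T : StrongMonad C) (D E : C) where
  app (X : C) : (ihom D).obj (T.obj X) ⟶ (ihom E).obj (T.obj X)
  naturality {X Y : C} (f : X ⟶ Y) :
    (ihom D).map (T.map f) ≫ app Y = app X ≫ (ihom E).map (T.map f)
  app_str (X Y : C) :
    push D X (T.obj Y) ≫ (ihom D).map (T.str X Y) ≫ app (X ⊗ Y) =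
      (X ◁ app Y) ≫ push E X (T.obj Y) ≫ (ihom E).map (T.str X Y)
  app_mul (X : C) :
    (ihom D).map (T.μ.app X) ≫ app X = app (T.obj X) ≫ (ihom E).map (T.μ.app X)

/-- The generic effect `E → T D` of an algebraic operation: the operation applied to the unit
`D → T D`, regarded as a global element of `D ⇒ T D`. -/
def AlgOp.gef {T : StrongMonad C} {D E : C} (o : AlgOp T D E) : E ⟶ T.obj D :=
  lift (toUnit E ≫ Lam (snd (𝟙_ C) D ≫ T.η.app D) ≫ o.app D) (𝟙 E) ≫ Ev E (T.obj D)

variable [HasInitial C] [HasBinaryCoproducts C]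

/-! ## Interpretation of types and contexts -/

/-- The interpretation of types of the computational lambda calculus. -/
def Ty.obj {B : Type a} (T : StrongMonad C) (A : B → C) : Ty B → C
  | .base x => A x
  | .unit => 𝟙_ C
  | .prod ρ τ => ρ.obj T A ⊗ τ.obj T A
  | .zero => ⊥_ C
  | .sum ρ τ => ρ.obj T A ⨿ τ.obj T A
  | .arr ρ τ => (ihom (ρ.obj T A)).obj (T.obj (τ.obj T A))

/-- The interpretation of types of the target language, with the answer type interpreted by `Ω`. -/
def TTy.obj {B : Type a} (A : B → C) (Ω : C) : TTy B → C
  | .R => Ω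
  | .base x => A x
  | .unit => 𝟙_ C
  | .prod ρ τ => ρ.obj A Ω ⊗ τ.obj A Ω
  | .zero => ⊥_ C
  | .sum ρ τ => ρ.obj A Ω ⨿ τ.obj A Ω
  | .neg ρ => (ihom (ρ.obj A Ω)).obj Ω

/-- The interpretations of a ground type in the two languages agree. -/
theorem Ty.obj_cps {B : Type a} (T : StrongMonad C) (A : B → C) (Ω : C) :
    ∀ {ρ : Ty B}, ρ.IsGround → ρ.obj T A = ρ.cps.obj A Ω
  | .base _, _ => rfl
  | .unit, _ => rfl
  | .prod _ _, h => congrArg₂ (fun X Y : C => X ⊗ Y) (Ty.obj_cps T A Ω h.1) (Ty.obj_cps T A Ω h.2)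
  | .zero, _ => rfl
  | .sum _ _, h => congrArg₂ (fun X Y : C => X ⨿ Y) (Ty.obj_cps T A Ω h.1) (Ty.obj_cps T A Ω h.2)

/-- The interpretations of a context of ground types in the two languages agree. -/
theorem ctxObj_cps {B : Type a} (T : StrongMonad C) (A : B → C) (Ω : C) :
    ∀ {Γ : List (Ty B)}, (∀ ρ ∈ Γ, ρ.IsGround) →
      ctxObj (Ty.obj T A) Γ = ctxObj (TTy.obj A Ω) (Γ.map Ty.cps)
  | [], _ => rfl
  | ρ :: _, h => congrArg₂ (fun X Y : C => X ⊗ Y)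
      (ctxObj_cps T A Ω (fun σ hσ => h σ (List.mem_cons_of_mem ρ hσ)))
      (Ty.obj_cps T A Ω (h ρ List.mem_cons_self))

/-! ## Interpretation of terms -/

/-- Structures for a signature in a bicartesian closed category `C`: a strong monad, and an
interpretation of the base types, of the effect-free constants and of the algebraic operations. -/
structure Str (S : Sig.{a, b, c}) (C : Type u) [Category.{v} C] [CartesianMonoidalCategory C]
    [MonoidalClosed C] [HasInitial C] [HasBinaryCoproducts C] where
  T : StrongMonad C
  base : S.B → C
  const (k : S.K) : (S.arK k).obj T base ⟶ (S.carK k).obj T base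
  op (o : S.O) : AlgOp T ((S.arO o).obj T base) ((S.carO o).obj T base)

namespace Str

variable {S : Sig.{a, b, c}} (A : Str S C)

/-- The interpretation of source types. -/
abbrev ty (ρ : Ty S.B) : C := ρ.obj A.T A.base

/-- The interpretation of source contexts. -/
abbrev ctx (Γ : List (Ty S.B)) : C := ctxObj A.ty Γ

/-- The interpretation of target types. -/
abbrev tty (ν : A.T.toMonad.Algebra) (ρ : TTy S.B) : C := ρ.obj A.base ν.A

/-- The interpretation of target contexts. -/
abbrev tctx (ν : A.T.toMonad.Algebra) (Γ : List (TTy S.B)) : C := ctxObj (A.tty ν) Γ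

/-- The identity between the two interpretations of a ground type. -/
def groundHom (ν : A.T.toMonad.Algebra) {ρ : Ty S.B} (h : ρ.IsGround) : A.ty ρ ⟶ A.tty ν ρ.cps :=
  eqToHom (Ty.obj_cps A.T A.base ν.A h)

/-- The same identity, in the other direction. -/
def groundInv (ν : A.T.toMonad.Algebra) {ρ : Ty S.B} (h : ρ.IsGround) : A.tty ν ρ.cps ⟶ A.ty ρ :=
  eqToHom (Ty.obj_cps A.T A.base ν.A h).symm

/-- The identity between the two interpretations of a context of ground types. -/
def groundCtxHom (ν : A.T.toMonad.Algebra) {Γ : List (Ty S.B)} (h : ∀ ρ ∈ Γ, ρ.IsGround) :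
    A.ctx Γ ⟶ A.tctx ν (Γ.map Ty.cps) :=
  eqToHom (ctxObj_cps A.T A.base ν.A h)

/-- The double strength `T X × T Y → T (X × Y)` that runs the left component first. -/
def dstr (T : StrongMonad C) (X Y : C) : T.obj X ⊗ T.obj Y ⟶ T.obj (X ⊗ Y) :=
  swap _ _ ≫ T.str (T.obj Y) X ≫ T.map (swap _ _) ≫ T.map (T.str X Y) ≫ T.μ.app (X ⊗ Y)

/-- The call-by-value interpretation of a source term as a morphism `Γ → T ρ`. -/
def sem {Γ : List (Ty S.B)} {ρ : Ty S.B} : Tm S Γ ρ → (A.ctx Γ ⟶ A.T.obj (A.ty ρ))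
  | .var x => x.proj A.ty ≫ A.T.η.app _
  | .const k M => sem M ≫ A.T.map (A.const k)
  | .op o ρ M => sem M ≫ A.T.map (Unlam ((A.op o).app (A.ty ρ))) ≫ A.T.μ.app _
  | .unit => toUnit _ ≫ A.T.η.app _
  | .pair M N => lift (sem M) (sem N) ≫ dstr A.T _ _
  | .fst M => sem M ≫ A.T.map (fst _ _)
  | .snd M => sem M ≫ A.T.map (snd _ _)
  | .absurd M => sem M ≫ A.T.map (initial.to _)
  | .inl M => sem M ≫ A.T.map coprod.inl
  | .inr M => sem M ≫ A.T.map coprod.inr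
  | .case M N₁ N₂ => lift (𝟙 _) (sem M) ≫ A.T.str _ _ ≫ A.T.map (leftDistrib _ _ _).inv ≫
      A.T.map (coprod.desc (sem N₁) (sem N₂)) ≫ A.T.μ.app _
  | .lam M => Lam (sem M) ≫ A.T.η.app _
  | .app M N => lift (sem M) (sem N) ≫ dstr A.T _ _ ≫ A.T.map (Ev _ _) ≫ A.T.μ.app _

/-- The interpretation of a target term as a morphism `Γ → ρ`. -/
def tsem (ν : A.T.toMonad.Algebra) {Γ : List (TTy S.B)} {ρ : TTy S.B} :
    TTm S Γ ρ → (A.tctx ν Γ ⟶ A.tty ν ρ)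
  | .var x => x.proj (A.tty ν)
  | .const k M => tsem ν M ≫ A.groundInv ν (S.arK_ground k) ≫ A.const k ≫
      A.groundHom ν (S.carK_ground k)
  | .op o M => tsem ν M ≫
      ((𝟙 _) ⊗ₘ (A.groundInv ν (S.carO_ground o) ≫ (A.op o).gef ≫
        A.T.map (A.groundHom ν (S.arO_ground o)))) ≫
      A.T.str _ _ ≫ A.T.map (Ev _ _) ≫ ν.a
  | .unit => toUnit _
  | .pair M N => lift (tsem ν M) (tsem ν N)
  | .fst M => tsem ν M ≫ fst _ _
  | .snd M => tsem ν M ≫ snd _ _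
  | .absurd M => tsem ν M ≫ initial.to _
  | .inl M => tsem ν M ≫ coprod.inl
  | .inr M => tsem ν M ≫ coprod.inr
  | .case M N₁ N₂ => lift (𝟙 _) (tsem ν M) ≫ (leftDistrib _ _ _).inv ≫
      coprod.desc (tsem ν N₁) (tsem ν N₂)
  | .lam M => Lam (tsem ν M)
  | .app M N => lift (tsem ν M) (tsem ν N) ≫ Ev _ _

end Str

end

end LambdaC

open LambdaC

/-! An Eilenberg–Moore algebra `ν : T Ω → Ω` turns a computation `W ⟶ T X` into a map from
postconditions to `Ω`, that is, into an element of the continuation monad with answers in `Ω`. The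
algebra laws make this a morphism of strong monads: `wpp_unit` handles values, `wpp_bind` handles
sequencing, and `wpp_algOp` shows that an operation becomes the modality of its generic effect. The
CPS transform interprets the source language in the continuation monad, so the theorem says that
interpretation commutes with this monad morphism.

Function types have different interpretations on the two sides (`X ⇒ T Y` against `(X × (Y ⇒ Ω)) ⇒
Ω`), so no plain induction on ground terms works. The interpretations are compared by a Kripke
logical relation `LR` on generalised elements: related functions, given related arguments and
related continuations, yield the same answer in `Ω`. The induction on terms is `fundamental`.

The delicate types are sums. A generalised element of a coproduct need not factor through an
injection, so two elements are related when all related pairs of branches give them the same answer.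
This observes elements only through `Ω`. A constant applied to arguments related in this way gives
results that agree only up to tests in `Ω`; hence at base types the relation is `Ω`-equivalence
(`OmegaEq`) and not equality. With this choice `LR` is `Ω`-equivalence at every ground type
(`LR_iff_omegaEq`). That is enough for the theorem, because the meaning of `P` is itself a test with
values in `Ω`. -/

namespace LambdaC

noncomputable section

/-! ### Generalised elements of exponentials; distributivity of products over coproducts -/

section Closed

variable {C : Type u} [Category.{v} C] [CartesianMonoidalCategory C]

@[simp]
theorem lift_swap {W X Y : C} (f : W ⟶ X) (g : W ⟶ Y) : lift f g ≫ swap X Y = lift g f := by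
  simp [swap]

variable [MonoidalClosed C]

/-- The β-law for generalised elements; every later evaluation of an abstraction reduces to it. -/
theorem lift_Lam_Ev {V X Y Z : C} (f : X ⊗ Y ⟶ Z) (h : V ⟶ X) (y : V ⟶ Y) :
    lift (h ≫ Lam f) y ≫ Ev Y Z = lift h y ≫ f := by
  have e : lift (h ≫ Lam f) y ≫ Ev Y Z =
      lift y h ≫ (Y ◁ MonoidalClosed.curry (swap Y X ≫ f)) ≫ (ihom.ev Y).app Z := by
    rw [lift_whiskerLeft_assoc, Ev, reassoc_of% lift_swap, Lam]
  rw [e, MonoidalClosed.whiskerLeft_curry_ihom_ev_app, reassoc_of% lift_swap]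

theorem Unlam_Lam {X Y Z : C} (f : X ⊗ Y ⟶ Z) : Unlam (Lam f) = f := by
  have e : Lam f ▷ Y = lift (fst X Y ≫ Lam f) (snd X Y) := by ext <;> simp
  rw [Unlam, e, lift_Lam_Ev, lift_fst_snd, Category.id_comp]

theorem Unlam_injective {X Y Z : C} {f g : X ⟶ (ihom Y).obj Z} (h : Unlam f = Unlam g) : f = g := by
  apply MonoidalClosed.uncurry_injective
  have e (f : X ⟶ (ihom Y).obj Z) : MonoidalClosed.uncurry f = swap Y X ≫ Unlam f := by
    have e' : Y ◁ f = lift (fst Y X) (snd Y X ≫ f) := by ext <;> simp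
    rw [MonoidalClosed.uncurry_eq, Unlam, Ev, swap, swap, lift_whiskerRight_assoc, e']
    simp only [← Category.assoc]
    congr 1
    ext <;> simp
  rw [e, e, h]

theorem lift_Unlam {V X Y Z : C} (g : X ⟶ (ihom Y).obj Z) (h : V ⟶ X) (y : V ⟶ Y) :
    lift h y ≫ Unlam g = lift (h ≫ g) y ≫ Ev Y Z := by
  simp [Unlam]

theorem comp_Lam {W X Y Z : C} (h : W ⟶ X) (f : X ⊗ Y ⟶ Z) :
    h ≫ Lam f = Lam ((h ▷ Y) ≫ f) := by
  apply Unlam_injective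
  rw [Unlam_Lam]
  have e : h ▷ Y = lift (fst W Y ≫ h) (snd W Y) := by ext <;> simp
  have e' : (h ≫ Lam f) ▷ Y = lift ((fst W Y ≫ h) ≫ Lam f) (snd W Y) := by ext <;> simp
  rw [Unlam, e', lift_Lam_Ev, e]

theorem lift_ihom_map_Ev {V Y Z Z' : C} (g : V ⟶ (ihom Y).obj Z) (y : V ⟶ Y) (f : Z ⟶ Z') :
    lift (g ≫ (ihom Y).map f) y ≫ Ev Y Z' = lift g y ≫ Ev Y Z ≫ f := by
  have e : lift (g ≫ (ihom Y).map f) y ≫ Ev Y Z' =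
      lift y g ≫ (Y ◁ (ihom Y).map f) ≫ (ihom.ev Y).app Z' := by
    rw [lift_whiskerLeft_assoc, Ev, reassoc_of% lift_swap]
  rw [e, ihom.ev_naturality, Ev, Category.assoc, reassoc_of% lift_swap]

/-- Currying turns maps out of `V ⊗ ⊥_ C` into maps out of `⊥_ C`, so any two of them agree;
precomposing with `lift (𝟙 V) u` recovers `f` and `g`. This settles everything about the empty type:
a stage with an element of it has at most one map to any object. -/
theorem eq_of_hom_initial [HasInitial C] {V Z : C} (u : V ⟶ ⊥_ C) (f g : V ⟶ Z) : f = g := by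
  have h : fst V (⊥_ C) ≫ f = fst V (⊥_ C) ≫ g := by
    apply MonoidalClosed.curry_injective
    exact initial.hom_ext _ _
  simpa using congrArg (fun t => lift (𝟙 V) u ≫ t) h

variable [HasBinaryCoproducts C]

/-- Case analysis in a context: the morphism out of `W ⊗ (X ⨿ Y)` determined by its restrictions
along the two injections. -/
def copair {W X Y Z : C} (f : W ⊗ X ⟶ Z) (g : W ⊗ Y ⟶ Z) : W ⊗ (X ⨿ Y) ⟶ Z :=
  (leftDistrib W X Y).inv ≫ coprod.desc f g

@[simp]
theorem whiskerLeft_inl_copair {W X Y Z : C} (f : W ⊗ X ⟶ Z) (g : W ⊗ Y ⟶ Z) :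
    (W ◁ coprod.inl) ≫ copair f g = f := by
  rw [copair, ← Category.assoc, whiskerLeft_coprod_inl_leftDistrib_inv]
  exact coprod.inl_desc f g

@[simp]
theorem whiskerLeft_inr_copair {W X Y Z : C} (f : W ⊗ X ⟶ Z) (g : W ⊗ Y ⟶ Z) :
    (W ◁ coprod.inr) ≫ copair f g = g := by
  rw [copair, ← Category.assoc, whiskerLeft_coprod_inr_leftDistrib_inv]
  exact coprod.inr_desc f g

theorem lift_inl_copair {V W X Y Z : C} (h : V ⟶ W) (x : V ⟶ X) (f : W ⊗ X ⟶ Z)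
    (g : W ⊗ Y ⟶ Z) : lift h (x ≫ coprod.inl) ≫ copair f g = lift h x ≫ f := by
  rw [← lift_whiskerLeft_assoc, whiskerLeft_inl_copair]

theorem lift_inr_copair {V W X Y Z : C} (h : V ⟶ W) (y : V ⟶ Y) (f : W ⊗ X ⟶ Z)
    (g : W ⊗ Y ⟶ Z) : lift h (y ≫ coprod.inr) ≫ copair f g = lift h y ≫ g := by
  rw [← lift_whiskerLeft_assoc, whiskerLeft_inr_copair]

/-- Products distribute over coproducts, so the two injections remain jointly epic after tensoring
with a parameter object. -/
theorem tensor_coprod_ext {W X Y Z : C} {f g : W ⊗ (X ⨿ Y) ⟶ Z}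
    (hl : (W ◁ coprod.inl) ≫ f = (W ◁ coprod.inl) ≫ g)
    (hr : (W ◁ coprod.inr) ≫ f = (W ◁ coprod.inr) ≫ g) : f = g := by
  rw [← cancel_epi (leftDistrib W X Y).hom]
  apply coprod.hom_ext
  · simpa using hl
  · simpa using hr

theorem whiskerRight_copair {V W X Y Z : C} (h : V ⟶ W) (f : W ⊗ X ⟶ Z) (g : W ⊗ Y ⟶ Z) :
    (h ▷ (X ⨿ Y)) ≫ copair f g = copair ((h ▷ X) ≫ f) ((h ▷ Y) ≫ g) := by
  apply tensor_coprod_ext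
  · rw [whisker_exchange_assoc]; simp
  · rw [whisker_exchange_assoc]; simp

theorem lift_copair {V W X Y Z : C} (h : V ⟶ W) (s : V ⟶ X ⨿ Y) (f : W ⊗ X ⟶ Z)
    (g : W ⊗ Y ⟶ Z) :
    lift h s ≫ copair f g = lift (𝟙 V) s ≫ copair ((h ▷ X) ≫ f) ((h ▷ Y) ≫ g) := by
  rw [← whiskerRight_copair]
  simp

theorem comp_lift_copair {V W X Y Z : C} (h : V ⟶ W) (s : W ⟶ X ⨿ Y) (f : W ⊗ X ⟶ Z)
    (g : W ⊗ Y ⟶ Z) :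
    h ≫ lift (𝟙 W) s ≫ copair f g =
      lift (𝟙 V) (h ≫ s) ≫ copair ((h ▷ X) ≫ f) ((h ▷ Y) ≫ g) := by
  rw [← lift_copair, ← Category.assoc, comp_lift, Category.comp_id]

theorem lift_copair_congr {W X Y Z : C} {s s' : W ⟶ X ⨿ Y} {f f' : W ⊗ X ⟶ Z}
    {g g' : W ⊗ Y ⟶ Z} (hs : s = s') (hf : f = f') (hg : g = g') :
    lift (𝟙 W) s ≫ copair f g = lift (𝟙 W) s' ≫ copair f' g' := by
  rw [hs, hf, hg]

end Closed

/-! ## Parametrised weakest preconditions -/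

section WP

variable {C : Type u} [Category.{v} C] [CartesianMonoidalCategory C]
variable {T : StrongMonad C}

/-- The weakest precondition of a postcondition `k` with parameters in the context `W`. -/
def wpp (ν : T.toMonad.Algebra) {W X : C} (m : W ⟶ T.obj X) (k : W ⊗ X ⟶ ν.A) : W ⟶ ν.A :=
  lift (𝟙 W) m ≫ T.str W X ≫ T.map k ≫ ν.a

theorem lift_str {V W W' X : C} (h : V ⟶ W) (m : V ⟶ T.obj X) (g : W ⟶ W') :
    lift (h ≫ g) m ≫ T.str W' X = lift h m ≫ T.str W X ≫ T.map (g ▷ X) := by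
  have := T.str_natural g (𝟙 X)
  rw [T.toFunctor.map_id, tensorHom_id, tensorHom_id] at this
  rw [← this]
  simp

theorem lift_map_str {V W X Y : C} (h : V ⟶ W) (m : V ⟶ T.obj X) (g : X ⟶ Y) :
    lift h (m ≫ T.map g) ≫ T.str W Y = lift h m ≫ T.str W X ≫ T.map (W ◁ g) := by
  have := T.str_natural (𝟙 W) g
  rw [id_tensorHom, id_tensorHom] at this
  rw [← this]
  simp

variable (ν : T.toMonad.Algebra)

theorem comp_wpp {V W X : C} (h : V ⟶ W) (m : W ⟶ T.obj X) (k : W ⊗ X ⟶ ν.A) :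
    h ≫ wpp ν m k = wpp ν (h ≫ m) ((h ▷ X) ≫ k) := by
  have e := lift_str (T := T) (𝟙 V) (h ≫ m) h
  rw [Category.id_comp] at e
  rw [wpp, wpp, Functor.map_comp, Category.assoc, ← reassoc_of% e, ← Category.assoc, comp_lift,
    Category.comp_id]

theorem wpp_unit {W X : C} (x : W ⟶ X) (k : W ⊗ X ⟶ ν.A) :
    wpp ν (x ≫ T.η.app X) k = lift (𝟙 W) x ≫ k := by
  have h1 : lift (𝟙 W) (x ≫ T.η.app X) = lift (𝟙 W) x ≫ (W ◁ T.η.app X) := by simp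
  have h2 := T.η.naturality k
  have h3 := ν.unit
  rw [Functor.id_map] at h2
  rw [wpp, h1, Category.assoc, ← Category.assoc (W ◁ _), T.str_unit, ← reassoc_of% h2, h3]
  simp

theorem wpp_map {W X Y : C} (m : W ⟶ T.obj X) (g : X ⟶ Y) (k : W ⊗ Y ⟶ ν.A) :
    wpp ν (m ≫ T.map g) k = wpp ν m ((W ◁ g) ≫ k) := by
  rw [wpp, reassoc_of% lift_map_str, wpp, Functor.map_comp, Category.assoc]

/-- The strength with parameters discarded is a projection, by its compatibility with the left
unitor. -/
theorem wpp_snd {W X : C} (m : W ⟶ T.obj X) (q : X ⟶ ν.A) :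
    wpp ν m (snd W X ≫ q) = wp ν m q := by
  have h1 : snd W X = (toUnit W ▷ X) ≫ (λ_ X).hom :=
    (whiskerRight_toUnit_comp_leftUnitor_hom W X).symm
  have h2 := lift_str (T := T) (𝟙 W) m (toUnit W)
  rw [wpp, h1]
  simp only [Functor.map_comp, Category.assoc]
  rw [← reassoc_of% h2, reassoc_of% (T.str_leftUnitor X)]
  simp [wp]

/-- The associator law of the strength: attaching a value `w` to the result of `m` can be postponed
to the postcondition, which has the whole stage `V` at its disposal. -/
theorem wpp_lift_str {V W X : C} (w : V ⟶ W) (m : V ⟶ T.obj X) (k : V ⊗ (W ⊗ X) ⟶ ν.A) :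
    wpp ν (lift w m ≫ T.str W X) k =
      wpp ν m (lift (fst V X) (lift (fst V X ≫ w) (snd V X)) ≫ k) := by
  have h1 : lift (𝟙 V) (lift w m ≫ T.str W X) ≫ T.str V (W ⊗ X) =
      lift (lift (𝟙 V) w) m ≫ T.str (V ⊗ W) X ≫ T.map (α_ V W X).hom := by
    rw [T.str_associator]
    simp
  have h2 := lift_str (T := T) (𝟙 V) m (lift (𝟙 V) w)
  have h3 : lift (fst V X) (lift (fst V X ≫ w) (snd V X)) = (lift (𝟙 V) w ▷ X) ≫ (α_ V W X).hom := by
    ext <;> simp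
  rw [Category.id_comp] at h2
  rw [wpp, reassoc_of% h1, reassoc_of% h2, h3, wpp]
  simp

/-- This is where associativity of the algebra `ν` enters, together with the compatibility of the
strength with `μ`. -/
theorem wpp_mul {W X : C} (m : W ⟶ T.obj (T.obj X)) (k : W ⊗ X ⟶ ν.A) :
    wpp ν (m ≫ T.μ.app X) k = wpp ν m (T.str W X ≫ T.map k ≫ ν.a) := by
  have h1 : lift (𝟙 W) (m ≫ T.μ.app X) = lift (𝟙 W) m ≫ (W ◁ T.μ.app X) := by simp
  have h2 := T.μ.naturality k
  have h3 := ν.assoc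
  simp only [Functor.comp_map] at h2
  rw [wpp, h1, Category.assoc, ← Category.assoc (W ◁ _), T.str_mul,
    Category.assoc, Category.assoc, ← reassoc_of% h2, h3, wpp]
  simp

/-- Weakest preconditions compose backwards along sequencing. This is the multiplication law of the
monad morphism from `T` to the continuation monad. -/
theorem wpp_bind {W X Y : C} (m : W ⟶ T.obj X) (f : W ⊗ X ⟶ T.obj Y) (k : W ⊗ Y ⟶ ν.A) :
    wpp ν (lift (𝟙 W) m ≫ T.str W X ≫ T.map f ≫ T.μ.app Y) k =
      wpp ν m (wpp ν f ((fst W X ▷ Y) ≫ k)) := by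
  have h := lift_str (T := T) (𝟙 (W ⊗ X)) f (fst W X)
  have e := wpp_mul ν ((lift (𝟙 W) m ≫ T.str W X) ≫ T.map f) k
  simp only [Category.assoc] at e
  rw [e, ← Category.assoc, wpp_map, wpp_lift_str]
  congr 1
  rw [wpp, Functor.map_comp, Category.assoc, ← reassoc_of% h]
  simp

theorem wpp_mul_map {W X Y : C} (m : W ⟶ T.obj X) (f : X ⟶ T.obj Y) (k : W ⊗ Y ⟶ ν.A) :
    wpp ν (m ≫ T.map f ≫ T.μ.app Y) k = wpp ν m (wpp ν (snd W X ≫ f) ((fst W X ▷ Y) ≫ k)) := by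
  rw [← wpp_bind]
  have h1 : snd W X = (toUnit W ▷ X) ≫ (λ_ X).hom :=
    (whiskerRight_toUnit_comp_leftUnitor_hom W X).symm
  have h2 := lift_str (T := T) (𝟙 W) m (toUnit W)
  have h3 := T.str_leftUnitor X
  rw [Functor.map_comp, h1, Functor.map_comp, Category.assoc, Category.assoc, ← reassoc_of% h2,
    reassoc_of% h3]
  simp

end WP

/-! ### Double strength, algebraic operations and their generic effects -/

section

variable {C : Type u} [Category.{v} C] [CartesianMonoidalCategory C] {T : StrongMonad C}

/-- The double strength is the sequencing of `m` and then `n`, so `wpp_bind` applies; the nesting of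
the two preconditions is that of the CPS clauses for pairs and applications. -/
theorem wpp_dstr (ν : T.toMonad.Algebra) {W X Y : C} (m : W ⟶ T.obj X) (n : W ⟶ T.obj Y)
    (k : W ⊗ (X ⊗ Y) ⟶ ν.A) :
    wpp ν (lift m n ≫ Str.dstr T X Y) k =
      wpp ν m (wpp ν (fst W X ≫ n)
        (lift (fst (W ⊗ X) Y ≫ fst W X) (lift (fst (W ⊗ X) Y ≫ snd W X) (snd (W ⊗ X) Y)) ≫ k)) := by
  have h := lift_str (T := T) (𝟙 W) m n
  rw [Category.id_comp] at h
  have e : lift m n ≫ Str.dstr T X Y = lift (𝟙 W) m ≫ T.str W X ≫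
      T.map (lift (snd W X) (fst W X ≫ n) ≫ T.str X Y) ≫ T.μ.app (X ⊗ Y) := by
    have e' : lift (snd W X) (fst W X ≫ n) = (n ▷ X) ≫ swap _ _ := by
      ext <;> simp [swap]
    rw [Str.dstr, reassoc_of% lift_swap, reassoc_of% h, e']
    simp only [Functor.map_comp, Category.assoc]
  rw [e, wpp_bind, wpp_lift_str]
  congr 2
  simp only [← Category.assoc]
  congr 1
  ext <;> simp

theorem lift_wpp_snd (ν : T.toMonad.Algebra) {V W X Y : C} (h : V ⟶ W) (x : V ⟶ X)
    (f : X ⟶ T.obj Y) (k : W ⊗ Y ⟶ ν.A) :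
    lift h x ≫ wpp ν (snd W X ≫ f) ((fst W X ▷ Y) ≫ k) = wpp ν (x ≫ f) ((h ▷ Y) ≫ k) := by
  rw [comp_wpp, lift_snd_assoc, ← Category.assoc, ← comp_whiskerRight, lift_fst]

variable [MonoidalClosed C]

theorem Unlam_eq {X Y Z : C} (g : X ⟶ (ihom Y).obj Z) :
    Unlam g = lift (fst X Y ≫ g) (snd X Y) ≫ Ev Y Z := by
  rw [← lift_Unlam, lift_fst_snd, Category.id_comp]

theorem lift_push_Ev {V D X Z : C} (x : V ⟶ X) (g : V ⟶ (ihom D).obj Z) (d : V ⟶ D) :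
    lift (lift x g ≫ push D X Z) d ≫ Ev D (X ⊗ Z) = lift x (lift g d ≫ Ev D Z) := by
  rw [push, lift_Lam_Ev]
  simp

/-- An algebraic operation is determined by its generic effect. An element `f` of `D ⇒ T X` is the
Kleisli extension of `f` applied to the element `η_D` of `D ⇒ T D`; naturality and compatibility
with strength and multiplication let the operation pass through this extension, so that it acts on
`η_D` alone. -/
theorem Unlam_algOp {D E : C} (o : AlgOp T D E) (X : C) :
    Unlam (o.app X) =
      ((ihom D).obj (T.obj X) ◁ o.gef) ≫ T.str _ _ ≫ T.map (Ev D (T.obj X)) ≫ T.μ.app X := by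
  set F : C := (ihom D).obj (T.obj X) with hF
  let name : 𝟙_ C ⟶ (ihom D).obj (T.obj D) := Lam (snd (𝟙_ C) D ≫ T.η.app D)
  let j : F ⟶ F ⊗ (ihom D).obj (T.obj D) := lift (𝟙 F) (toUnit F ≫ name)
  let φ : F ⊗ T.obj D ⟶ T.obj X := T.str F D ≫ T.map (Ev D (T.obj X)) ≫ T.μ.app X
  have hname {V : C} (d : V ⟶ D) : lift (toUnit V ≫ name) d ≫ Ev D (T.obj D) = d ≫ T.η.app D := by
    rw [lift_Lam_Ev, lift_snd_assoc]
  have hφ : (F ◁ T.η.app D) ≫ φ = Ev D (T.obj X) := by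
    have h2 := T.η.naturality (Ev D (T.obj X))
    rw [Functor.id_map] at h2
    rw [← Category.assoc, T.str_unit, ← Category.assoc, ← h2, Category.assoc]
    erw [T.left_unit]
    exact Category.comp_id _
  -- The decomposition of `f`: `j` pairs it with the name of `η_D`, and `φ (f, η d) = f d`.
  have hid : j ≫ push D F (T.obj D) ≫ (ihom D).map φ = 𝟙 F := by
    apply Unlam_injective
    have e : fst F D ≫ j = lift (fst F D) (toUnit (F ⊗ D) ≫ name) := by
      ext
      · simp [j]
      · simp only [j, Category.assoc, lift_snd]
        rw [← Category.assoc, comp_toUnit]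
    have e' : lift (fst F D) (snd F D ≫ T.η.app D) = F ◁ T.η.app D := by ext <;> simp
    rw [Unlam_eq, Unlam_eq, reassoc_of% e, ← Category.assoc, lift_ihom_map_Ev,
      ← Category.assoc, lift_push_Ev, hname, e', hφ, Category.comp_id, lift_fst_snd,
      Category.id_comp]
  -- Multiplication, naturality and strength, in this order, move `o` leftwards past the three
  -- factors of `φ`.
  have hmain : o.app X = j ≫ (F ◁ o.app D) ≫ push E F (T.obj D) ≫ (ihom E).map φ := by
    have h1 := o.app_str F D
    have h2 := o.naturality (Ev D (T.obj X))
    have h3 := o.app_mul X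
    calc o.app X = (j ≫ push D F (T.obj D) ≫ (ihom D).map φ) ≫ o.app X := by
          rw [hid, Category.id_comp]
      _ = _ := by
          simp only [φ, Functor.map_comp, Category.assoc, h3]
          rw [reassoc_of% h2, reassoc_of% h1]
  have e : fst F E ≫ j ≫ (F ◁ o.app D) =
      lift (fst F E) (toUnit (F ⊗ E) ≫ name ≫ o.app D) := by
    ext
    · simp [j]
    · simp only [j, Category.assoc, lift_snd, whiskerLeft_snd, lift_snd_assoc]
      rw [← Category.assoc, comp_toUnit]
  have e' : F ◁ o.gef = lift (fst F E)
      (lift (toUnit (F ⊗ E) ≫ name ≫ o.app D) (snd F E) ≫ Ev E (T.obj D)) := by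
    ext
    · simp
    · simp only [whiskerLeft_snd, lift_snd, AlgOp.gef]
      rw [← Category.assoc, comp_lift, ← Category.assoc, comp_toUnit, Category.comp_id]
  rw [Unlam_eq, hmain, ← Category.assoc j, ← Category.assoc (fst F E), e, ← Category.assoc,
    lift_ihom_map_Ev, ← Category.assoc, lift_push_Ev, e']

/-- The operation becomes the weakest precondition of its generic effect, the postcondition being
that of the continuation `f` at a generic argument in `D`. This is the shape of the target modality.
-/
theorem wpp_algOp (ν : T.toMonad.Algebra) {D E V X : C} (o : AlgOp T D E)
    (f : V ⟶ (ihom D).obj (T.obj X)) (e : V ⟶ E) (k : V ⊗ X ⟶ ν.A) :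
    wpp ν (lift f e ≫ Unlam (o.app X)) k =
      wpp ν (e ≫ o.gef)
        (wpp ν (lift (fst V D ≫ f) (snd V D) ≫ Ev D (T.obj X)) ((fst V D ▷ X) ≫ k)) := by
  rw [Unlam_algOp, lift_whiskerLeft_assoc, ← Category.assoc (lift f _), wpp_mul_map, wpp_lift_str,
    lift_wpp_snd]

variable [HasBinaryCoproducts C]

theorem wpp_copair (ν : T.toMonad.Algebra) {W X Y Z : C} (f : W ⊗ X ⟶ T.obj Z)
    (g : W ⊗ Y ⟶ T.obj Z) (k : W ⊗ Z ⟶ ν.A) :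
    wpp ν (copair f g) ((fst W (X ⨿ Y) ▷ Z) ≫ k) =
      copair (wpp ν f ((fst W X ▷ Z) ≫ k)) (wpp ν g ((fst W Y ▷ Z) ≫ k)) := by
  apply tensor_coprod_ext
  · rw [comp_wpp, whiskerLeft_inl_copair, whiskerLeft_inl_copair, ← Category.assoc,
      ← comp_whiskerRight, whiskerLeft_fst]
  · rw [comp_wpp, whiskerLeft_inr_copair, whiskerLeft_inr_copair, ← Category.assoc,
      ← comp_whiskerRight, whiskerLeft_fst]

end

section

variable {C : Type u} [Category.{v} C] [CartesianMonoidalCategory C] [MonoidalClosed C]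
  [HasInitial C] [HasBinaryCoproducts C] {S : Sig.{a, b, c}} (A : Str S C)
  (ν : A.T.toMonad.Algebra)

namespace Str

/-! ## Semantics of renaming and substitution -/

theorem comp_tsem_case {V : C} {Γ : List (TTy S.B)} {ρ₁ ρ₂ : TTy S.B} (e : V ⟶ A.tctx ν Γ)
    (M : TTm S Γ (.sum ρ₁ ρ₂)) (N₁ : TTm S (ρ₁ :: Γ) .R) (N₂ : TTm S (ρ₂ :: Γ) .R) :
    e ≫ A.tsem ν (.case M N₁ N₂) =
      lift (𝟙 V) (e ≫ A.tsem ν M) ≫ copair (W := V) (X := A.tty ν ρ₁) (Y := A.tty ν ρ₂)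
        ((e ▷ A.tty ν ρ₁) ≫ A.tsem ν N₁) ((e ▷ A.tty ν ρ₂) ≫ A.tsem ν N₂) := by
  exact comp_lift_copair e (A.tsem ν M) (A.tsem ν N₁) (A.tsem ν N₂)

theorem proj_ren_lift {Γ Δ : List (TTy S.B)} (r : Ren Γ Δ) (s : A.tctx ν Δ ⟶ A.tctx ν Γ)
    (h : ∀ σ (x : Var Γ σ), (r σ x).proj (A.tty ν) = s ≫ x.proj (A.tty ν)) (τ : TTy S.B) :
    ∀ σ (x : Var (τ :: Γ) σ), (r.lift τ σ x).proj (A.tty ν) =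
      (s ▷ A.tty ν τ : A.tctx ν (τ :: Δ) ⟶ A.tctx ν (τ :: Γ)) ≫ x.proj (A.tty ν) := by
  intro σ x
  cases x with
  | z => exact (whiskerRight_snd s (A.tty ν τ)).symm
  | s x =>
    change fst _ _ ≫ (r σ x).proj (A.tty ν) = (s ▷ A.tty ν τ) ≫ fst _ _ ≫ x.proj (A.tty ν)
    rw [h, whiskerRight_fst_assoc]

/-- Any morphism `s` that agrees with `r` on variables interprets it on all terms; under a binder
`s` becomes its whiskering with the new type. -/
theorem tsem_rename {Γ : List (TTy S.B)} {ρ : TTy S.B} (M : TTm S Γ ρ) :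
    ∀ {Δ : List (TTy S.B)} (r : Ren Γ Δ) (s : A.tctx ν Δ ⟶ A.tctx ν Γ),
      (∀ σ (x : Var Γ σ), (r σ x).proj (A.tty ν) = s ≫ x.proj (A.tty ν)) →
      A.tsem ν (M.rename r) = s ≫ A.tsem ν M := by
  induction M with
  | var x => intro Δ r s h; exact h _ x
  | unit => intro Δ r s h; exact toUnit_unique _ _
  | const k M ih | fst M ih | snd M ih | absurd M ih | inl M ih | inr M ih | op o M ih =>
    intro Δ r s h
    simp only [TTm.rename, tsem, ih r s h]
    exact Category.assoc _ _ _
  | pair M N ih₁ ih₂ =>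
    intro Δ r s h
    simp only [TTm.rename, tsem, ih₁ r s h, ih₂ r s h]
    exact (comp_lift _ _ _).symm
  | app M N ih₁ ih₂ =>
    intro Δ r s h
    simp only [TTm.rename, tsem, ih₁ r s h, ih₂ r s h]
    exact (comp_lift_assoc _ _ _ _).symm
  | case M N₁ N₂ ih ih₁ ih₂ =>
    intro Δ r s h
    exact (lift_copair_congr (ih r s h) (ih₁ (r.lift _) _ (proj_ren_lift A ν r s h _))
      (ih₂ (r.lift _) _ (proj_ren_lift A ν r s h _))).trans (comp_lift_copair _ _ _ _).symm
  | lam M ih =>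
    intro Δ r s h
    exact (congrArg Lam (ih (r.lift _) _ (proj_ren_lift A ν r s h _))).trans (comp_Lam _ _).symm

theorem tsem_wk {Γ : List (TTy S.B)} {ρ : TTy S.B} (σ : TTy S.B) (M : TTm S Γ ρ) :
    A.tsem ν (M.wk σ) = fst (A.tctx ν Γ) (A.tty ν σ) ≫ A.tsem ν M :=
  tsem_rename A ν M _ _ fun _ _ => rfl

theorem tsem_subst {Γ : List (TTy S.B)} {ρ : TTy S.B} (M : TTm S Γ ρ) :
    ∀ {Δ : List (TTy S.B)} (f : ∀ σ, Var Γ σ → TTm S Δ σ) (s : A.tctx ν Δ ⟶ A.tctx ν Γ),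
      (∀ σ (x : Var Γ σ), A.tsem ν (f σ x) = s ≫ x.proj (A.tty ν)) →
      A.tsem ν (M.subst f) = s ≫ A.tsem ν M := by
  have lift_ok {Γ Δ : List (TTy S.B)} (f : ∀ σ, Var Γ σ → TTm S Δ σ)
      (s : A.tctx ν Δ ⟶ A.tctx ν Γ)
      (h : ∀ σ (x : Var Γ σ), A.tsem ν (f σ x) = s ≫ x.proj (A.tty ν)) (τ : TTy S.B) :
      ∀ σ (x : Var (τ :: Γ) σ), A.tsem ν (TTm.liftSubst f τ σ x) =
        (s ▷ A.tty ν τ : A.tctx ν (τ :: Δ) ⟶ A.tctx ν (τ :: Γ)) ≫ x.proj (A.tty ν) := by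
    intro σ x
    cases x with
    | z => exact (whiskerRight_snd s (A.tty ν τ)).symm
    | s x =>
      change A.tsem ν ((f σ x).wk τ) = (s ▷ A.tty ν τ) ≫ fst _ _ ≫ x.proj (A.tty ν)
      rw [tsem_wk, h, whiskerRight_fst_assoc]
  induction M with
  | var x => intro Δ f s h; exact h _ x
  | unit => intro Δ f s h; exact toUnit_unique _ _
  | const k M ih | fst M ih | snd M ih | absurd M ih | inl M ih | inr M ih | op o M ih =>
    intro Δ f s h
    simp only [TTm.subst, tsem, ih f s h]
    exact Category.assoc _ _ _
  | pair M N ih₁ ih₂ =>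
    intro Δ f s h
    simp only [TTm.subst, tsem, ih₁ f s h, ih₂ f s h]
    exact (comp_lift _ _ _).symm
  | app M N ih₁ ih₂ =>
    intro Δ f s h
    simp only [TTm.subst, tsem, ih₁ f s h, ih₂ f s h]
    exact (comp_lift_assoc _ _ _ _).symm
  | case M N₁ N₂ ih ih₁ ih₂ =>
    intro Δ f s h
    exact (lift_copair_congr (ih f s h) (ih₁ (TTm.liftSubst f _) _ (lift_ok f s h _))
      (ih₂ (TTm.liftSubst f _) _ (lift_ok f s h _))).trans (comp_lift_copair _ _ _ _).symm
  | lam M ih =>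
    intro Δ f s h
    exact (congrArg Lam (ih (TTm.liftSubst f _) _ (lift_ok f s h _))).trans (comp_Lam _ _).symm

/-! ## Evaluation of target terms in an environment -/

variable {A ν} {V W : C} {Γ : List (TTy S.B)} {ρ τ : TTy S.B}

/-- Extension of an environment by a value. -/
def snoc (e : V ⟶ A.tctx ν Γ) (x : V ⟶ A.tty ν ρ) : V ⟶ A.tctx ν (ρ :: Γ) :=
  lift e x

/-- Application of a generalised element of a function type of the target language. -/
def ap (f : V ⟶ A.tty ν (.neg ρ)) (x : V ⟶ A.tty ν ρ) : V ⟶ A.tty ν .R :=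
  lift f x ≫ Ev (A.tty ν ρ) ν.A

/-- The pair of two generalised elements. -/
def duo (x : V ⟶ A.tty ν ρ) (y : V ⟶ A.tty ν τ) : V ⟶ A.tty ν (.prod ρ τ) :=
  lift x y

/-- The first component of a generalised element of a product type. -/
def p₁ (x : V ⟶ A.tty ν (.prod ρ τ)) : V ⟶ A.tty ν ρ :=
  x ≫ fst (A.tty ν ρ) (A.tty ν τ)

/-- The second component of a generalised element of a product type. -/
def p₂ (x : V ⟶ A.tty ν (.prod ρ τ)) : V ⟶ A.tty ν τ :=
  x ≫ snd (A.tty ν ρ) (A.tty ν τ)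

/-- The first injection of a generalised element. -/
def i₁ (x : V ⟶ A.tty ν ρ) : V ⟶ A.tty ν (.sum ρ τ) :=
  x ≫ (coprod.inl : A.tty ν ρ ⟶ A.tty ν ρ ⨿ A.tty ν τ)

/-- The second injection of a generalised element. -/
def i₂ (x : V ⟶ A.tty ν τ) : V ⟶ A.tty ν (.sum ρ τ) :=
  x ≫ (coprod.inr : A.tty ν τ ⟶ A.tty ν ρ ⨿ A.tty ν τ)

/-- The modal operator of an algebraic operation, applied to generalised elements. -/
def modal (o : S.O) (f : V ⟶ A.tty ν (.neg (S.arO o).cps)) (x : V ⟶ A.tty ν (S.carO o).cps) :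
    V ⟶ A.tty ν .R :=
  lift f (x ≫ A.groundInv ν (S.carO_ground o) ≫ (A.op o).gef ≫
      A.T.map (A.groundHom ν (S.arO_ground o))) ≫
    A.T.str _ _ ≫ A.T.map (Ev (A.tty ν (S.arO o).cps) ν.A) ≫ ν.a

theorem p₁_duo (x : V ⟶ A.tty ν ρ) (y : V ⟶ A.tty ν τ) : p₁ (duo x y) = x :=
  lift_fst _ _

theorem p₂_duo (x : V ⟶ A.tty ν ρ) (y : V ⟶ A.tty ν τ) : p₂ (duo x y) = y :=
  lift_snd _ _

theorem comp_snoc (h : W ⟶ V) (e : V ⟶ A.tctx ν Γ) (x : V ⟶ A.tty ν ρ) :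
    h ≫ snoc e x = snoc (h ≫ e) (h ≫ x) :=
  comp_lift _ _ _

theorem comp_ap (h : W ⟶ V) (f : V ⟶ A.tty ν (.neg ρ)) (x : V ⟶ A.tty ν ρ) :
    h ≫ ap f x = ap (h ≫ f) (h ≫ x) :=
  comp_lift_assoc _ _ _ _

theorem comp_p₁ (h : W ⟶ V) (x : V ⟶ A.tty ν (.prod ρ τ)) : h ≫ p₁ x = p₁ (h ≫ x) :=
  (Category.assoc _ _ _).symm

theorem comp_p₂ (h : W ⟶ V) (x : V ⟶ A.tty ν (.prod ρ τ)) : h ≫ p₂ x = p₂ (h ≫ x) :=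
  (Category.assoc _ _ _).symm

theorem snoc_tsem_var_zero (e : V ⟶ A.tctx ν Γ) (x : V ⟶ A.tty ν ρ) :
    snoc e x ≫ A.tsem ν (.var .z) = x :=
  lift_snd _ _

theorem snoc_tsem_var_succ (e : V ⟶ A.tctx ν Γ) (x : V ⟶ A.tty ν ρ) (y : Var Γ τ) :
    snoc e x ≫ A.tsem ν (.var (.s y)) = e ≫ A.tsem ν (.var y) :=
  lift_fst_assoc _ _ _

theorem snoc_tsem_wk (e : V ⟶ A.tctx ν Γ) (x : V ⟶ A.tty ν ρ) (M : TTm S Γ τ) :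
    snoc e x ≫ A.tsem ν (M.wk ρ) = e ≫ A.tsem ν M := by
  rw [tsem_wk]
  exact lift_fst_assoc _ _ _

theorem snoc_tsem_rename_lift {σ : TTy S.B} {Δ : List (TTy S.B)} (r : Ren Γ Δ)
    (s : A.tctx ν Δ ⟶ A.tctx ν Γ)
    (h : ∀ σ (x : Var Γ σ), (r σ x).proj (A.tty ν) = s ≫ x.proj (A.tty ν))
    (e : V ⟶ A.tctx ν Δ) (y : V ⟶ A.tty ν τ) (M : TTm S (τ :: Γ) σ) :
    snoc e y ≫ A.tsem ν (M.rename (r.lift τ)) = snoc (e ≫ s) y ≫ A.tsem ν M := by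
  rw [tsem_rename A ν M _ _ (proj_ren_lift A ν r s h τ)]
  exact lift_whiskerRight_assoc _ _ _ _

theorem snoc_tsem_rename_lift_wk {σ : TTy S.B} (e : V ⟶ A.tctx ν Γ) (x : V ⟶ A.tty ν ρ)
    (y : V ⟶ A.tty ν τ) (M : TTm S (τ :: Γ) σ) :
    snoc (snoc e x) y ≫ A.tsem ν (M.rename (Ren.lift (fun _ z => .s z) τ)) =
      snoc e y ≫ A.tsem ν M := by
  rw [snoc_tsem_rename_lift (fun _ z => .s z) (fst (A.tctx ν Γ) (A.tty ν ρ)) fun _ _ => rfl]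
  exact congrArg (fun t => snoc t y ≫ A.tsem ν M) (lift_fst _ _)

theorem snoc_tsem_rename_lift_wk_wk {σ ρ' : TTy S.B} (e : V ⟶ A.tctx ν Γ) (x : V ⟶ A.tty ν ρ)
    (x' : V ⟶ A.tty ν ρ') (y : V ⟶ A.tty ν τ) (M : TTm S (τ :: Γ) σ) :
    snoc (snoc (snoc e x) x') y ≫ A.tsem ν (M.rename (Ren.lift (fun _ z => .s (.s z)) τ)) =
      snoc e y ≫ A.tsem ν M := by
  let s₁ : A.tctx ν (ρ :: Γ) ⟶ A.tctx ν Γ := fst (A.tctx ν Γ) (A.tty ν ρ)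
  let s₂ : A.tctx ν (ρ' :: ρ :: Γ) ⟶ A.tctx ν (ρ :: Γ) := fst (A.tctx ν (ρ :: Γ)) (A.tty ν ρ')
  have h₁ : snoc e x ≫ s₁ = e := lift_fst _ _
  have h₂ : snoc (snoc e x) x' ≫ s₂ = snoc e x := lift_fst _ _
  rw [snoc_tsem_rename_lift (fun _ z => .s (.s z)) (s₂ ≫ s₁)
    fun _ _ => (Category.assoc _ _ _).symm, ← Category.assoc, h₂, h₁]

theorem comp_tsem_const {V : C} {Γ : List (TTy S.B)} (e : V ⟶ A.tctx ν Γ) (k : S.K)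
    (M : TTm S Γ (S.arK k).cps) :
    e ≫ A.tsem ν (.const k M) =
      (e ≫ A.tsem ν M) ≫ A.groundInv ν (S.arK_ground k) ≫ A.const k ≫
        A.groundHom ν (S.carK_ground k) :=
  (Category.assoc _ _ _).symm

theorem comp_tsem_op (e : V ⟶ A.tctx ν Γ) (o : S.O)
    (M : TTm S Γ (.prod (.neg (S.arO o).cps) (S.carO o).cps)) :
    e ≫ A.tsem ν (.op o M) = modal o (p₁ (e ≫ A.tsem ν M)) (p₂ (e ≫ A.tsem ν M)) := by
  have key {X Y Z U : C} (m : V ⟶ X ⊗ Y) (g : Y ⟶ Z) (r : X ⊗ Z ⟶ U) :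
      m ≫ (𝟙 X ⊗ₘ g) ≫ r = lift (m ≫ fst X Y) ((m ≫ snd X Y) ≫ g) ≫ r := by
    rw [← Category.assoc]
    congr 1
    ext <;> simp
  exact (Category.assoc _ _ _).symm.trans (key _ _ _)

theorem comp_tsem_pair (e : V ⟶ A.tctx ν Γ) (M : TTm S Γ ρ) (N : TTm S Γ τ) :
    e ≫ A.tsem ν (.pair M N) = duo (e ≫ A.tsem ν M) (e ≫ A.tsem ν N) :=
  comp_lift _ _ _

theorem comp_tsem_fst (e : V ⟶ A.tctx ν Γ) (M : TTm S Γ (.prod ρ τ)) :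
    e ≫ A.tsem ν (.fst M) = p₁ (e ≫ A.tsem ν M) :=
  (Category.assoc _ _ _).symm

theorem comp_tsem_snd (e : V ⟶ A.tctx ν Γ) (M : TTm S Γ (.prod ρ τ)) :
    e ≫ A.tsem ν (.snd M) = p₂ (e ≫ A.tsem ν M) :=
  (Category.assoc _ _ _).symm

theorem comp_tsem_inl (e : V ⟶ A.tctx ν Γ) (M : TTm S Γ ρ) :
    e ≫ A.tsem ν (.inl M : TTm S Γ (.sum ρ τ)) = i₁ (e ≫ A.tsem ν M) :=
  (Category.assoc _ _ _).symm

theorem comp_tsem_inr (e : V ⟶ A.tctx ν Γ) (M : TTm S Γ τ) :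
    e ≫ A.tsem ν (.inr M : TTm S Γ (.sum ρ τ)) = i₂ (e ≫ A.tsem ν M) :=
  (Category.assoc _ _ _).symm

theorem comp_tsem_app (e : V ⟶ A.tctx ν Γ) (M : TTm S Γ (.neg ρ)) (N : TTm S Γ ρ) :
    e ≫ A.tsem ν (.app M N) = ap (e ≫ A.tsem ν M) (e ≫ A.tsem ν N) :=
  comp_lift_assoc _ _ _ _

theorem ap_tsem_lam (e : V ⟶ A.tctx ν Γ) (x : V ⟶ A.tty ν ρ) (M : TTm S (ρ :: Γ) .R) :
    ap (e ≫ A.tsem ν (.lam M)) x = snoc e x ≫ A.tsem ν M :=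
  lift_Lam_Ev _ _ _

theorem ap_tsem_plam (e : V ⟶ A.tctx ν Γ) (x : V ⟶ A.tty ν (.prod ρ τ))
    (M : TTm S (τ :: ρ :: Γ) .R) :
    ap (e ≫ A.tsem ν (.plam M)) x = snoc (snoc e (p₁ x)) (p₂ x) ≫ A.tsem ν M := by
  let q : A.tctx ν (.prod ρ τ :: Γ) ⟶ A.tty ν (.prod ρ τ) :=
    snd (A.tctx ν Γ) (A.tty ν (.prod ρ τ))
  let r : A.tctx ν (.prod ρ τ :: Γ) ⟶ A.tctx ν Γ :=
    fst (A.tctx ν Γ) (A.tty ν (.prod ρ τ))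
  -- The substitution `projSubst` is interpreted by the environment made of the old one and the two
  -- projections of the bound pair.
  rw [TTm.plam, ap_tsem_lam, tsem_subst A ν M TTm.projSubst (snoc (snoc r (p₁ q)) (p₂ q)),
    ← Category.assoc, comp_snoc, comp_snoc, comp_p₁, comp_p₂]
  · have hq : snoc e x ≫ q = x := lift_snd _ _
    have hr : snoc e x ≫ r = e := lift_fst _ _
    rw [hq, hr]
  · intro σ y
    cases y with
    | z => exact (lift_snd _ _).symm
    | s y =>
      cases y with
      | z => exact ((lift_fst_assoc _ _ _).trans (lift_snd _ _)).symm
      | s y => exact ((lift_fst_assoc _ _ _).trans (lift_fst_assoc _ _ _)).symm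

end Str

end

/-! ### Ω-equivalence of generalised elements -/

section

variable {C : Type u} [Category.{v} C] [CartesianMonoidalCategory C]

/-- Two generalised elements are `Ω`-equivalent if no parametrised test with values in `Ω`
separates them. -/
def OmegaEq (Ω : C) {W X : C} (x y : W ⟶ X) : Prop :=
  ∀ (V : C) (h : V ⟶ W) (q : V ⊗ X ⟶ Ω), lift (𝟙 V) (h ≫ x) ≫ q = lift (𝟙 V) (h ≫ y) ≫ q

namespace OmegaEq

variable {Ω W X Y : C}

theorem refl (x : W ⟶ X) : OmegaEq Ω x x := fun _ _ _ => rfl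

theorem test {x y : W ⟶ X} (hxy : OmegaEq Ω x y) {V U : C} (h : V ⟶ W) (a : V ⟶ U)
    (q : U ⊗ X ⟶ Ω) : lift a (h ≫ x) ≫ q = lift a (h ≫ y) ≫ q := by
  simpa using hxy V h ((a ▷ X) ≫ q)

theorem precomp {x y : W ⟶ X} (hxy : OmegaEq Ω x y) {V : C} (h : V ⟶ W) :
    OmegaEq Ω (h ≫ x) (h ≫ y) := by
  intro U g q
  simpa only [Category.assoc] using hxy U (g ≫ h) q

theorem comp {x y : W ⟶ X} (hxy : OmegaEq Ω x y) (f : X ⟶ Y) : OmegaEq Ω (x ≫ f) (y ≫ f) := by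
  intro V h q
  simpa using hxy V h ((V ◁ f) ≫ q)

/-- The components are exchanged one at a time, the other one serving as a parameter of the test;
this needs tests with parameters. -/
theorem prod {x y : W ⟶ X ⊗ Y} (h₁ : OmegaEq Ω (x ≫ fst X Y) (y ≫ fst X Y))
    (h₂ : OmegaEq Ω (x ≫ snd X Y) (y ≫ snd X Y)) : OmegaEq Ω x y := by
  intro V h q
  -- Replaces the first component of `x`, with the second component of `x` as parameter.
  have e₁ := h₁.test h (lift (𝟙 V) (h ≫ x ≫ snd X Y))
    (lift (fst _ _ ≫ fst _ _) (lift (snd _ _) (fst _ _ ≫ snd _ _)) ≫ q)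
  -- Replaces the second component, with the first component of `y` as parameter.
  have e₂ := h₂.test h (lift (𝟙 V) (h ≫ y ≫ fst X Y))
    (lift (fst _ _ ≫ fst _ _) (lift (fst _ _ ≫ snd _ _) (snd _ _)) ≫ q)
  have hx (z : W ⟶ X ⊗ Y) : h ≫ z = lift (h ≫ z ≫ fst X Y) (h ≫ z ≫ snd X Y) := by
    ext <;> simp
  simp only [← Category.assoc, comp_lift, lift_fst, lift_snd] at e₁ e₂
  rw [hx x, hx y]
  simp only [← Category.assoc]
  exact e₁.trans e₂

end OmegaEq

theorem eqToHom_congrArg₂_tensor {X X' Y Y' : C} (hX : X = X') (hY : Y = Y') :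
    eqToHom (congrArg₂ (fun X Y : C => X ⊗ Y) hX hY) = eqToHom hX ⊗ₘ eqToHom hY := by
  subst hX hY
  simp

theorem lift_comp_comp {V W X Y Z U : C} (a : V ⟶ U) (g : V ⟶ W) (x : W ⟶ X) (f : X ⟶ Y)
    (q : U ⊗ Y ⟶ Z) : lift a (g ≫ x ≫ f) ≫ q = lift a (g ≫ x) ≫ (U ◁ f) ≫ q := by
  simp

theorem eqToHom_congrArg₂_coprod {C : Type u} [Category.{v} C] [HasBinaryCoproducts C]
    {X X' Y Y' : C} (hX : X = X') (hY : Y = Y') :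
    eqToHom (congrArg₂ (fun X Y : C => X ⨿ Y) hX hY) =
      coprod.map (eqToHom hX) (eqToHom hY) := by
  subst hX hY
  simp

variable [MonoidalClosed C] [HasBinaryCoproducts C]

theorem copair_whiskerLeft {W X Y X' Y' Z : C} (f : X ⟶ X') (g : Y ⟶ Y') (q : W ⊗ X' ⟶ Z)
    (r : W ⊗ Y' ⟶ Z) :
    copair ((W ◁ f) ≫ q) ((W ◁ g) ≫ r) = (W ◁ coprod.map f g) ≫ copair q r := by
  apply tensor_coprod_ext
  · rw [whiskerLeft_inl_copair, ← whiskerLeft_comp_assoc, coprod.inl_map, whiskerLeft_comp_assoc,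
      whiskerLeft_inl_copair]
  · rw [whiskerLeft_inr_copair, ← whiskerLeft_comp_assoc, coprod.inr_map, whiskerLeft_comp_assoc,
      whiskerLeft_inr_copair]

theorem copair_eta {W X Y Z : C} (q : W ⊗ (X ⨿ Y) ⟶ Z) :
    copair ((W ◁ coprod.inl) ≫ q) ((W ◁ coprod.inr) ≫ q) = q := by
  apply tensor_coprod_ext
  · rw [whiskerLeft_inl_copair]
  · rw [whiskerLeft_inr_copair]

variable [HasInitial C] {S : Sig.{a, b, c}} (A : Str S C)
  (ν : A.T.toMonad.Algebra)

namespace Str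

/-! ## The logical relation -/

variable {A ν} in
/-- A postcondition and a continuation are related if they send related arguments to the same
answer. -/
def ContRel {ρ : Ty S.B} (R : ∀ W : C, (W ⟶ A.ty ρ) → (W ⟶ A.tty ν ρ.cps) → Prop) {V : C}
    (k : V ⊗ A.ty ρ ⟶ ν.A) (κ : V ⟶ A.tty ν (.neg ρ.cps)) : Prop :=
  ∀ (W : C) (h : W ⟶ V) (x : W ⟶ A.ty ρ) (y : W ⟶ A.tty ν ρ.cps), R W x y →
    lift h x ≫ k = ap (h ≫ κ) y

/-- The logical relation between the generalised elements of a source type and of its CPS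
transform. -/
def LR : ∀ (ρ : Ty S.B) (W : C), (W ⟶ A.ty ρ) → (W ⟶ A.tty ν ρ.cps) → Prop
  | .base b, W, x, y => OmegaEq (W := W) (X := A.base b) ν.A x y
  | .unit, _, _, _ => True
  | .zero, _, _, _ => True
  | .prod ρ τ, W, x, y =>
      LR ρ W (x ≫ fst (A.ty ρ) (A.ty τ)) (p₁ y) ∧ LR τ W (x ≫ snd (A.ty ρ) (A.ty τ)) (p₂ y)
  -- Orthogonality to related pairs of branches; asking for a common injection would be too strong,
  -- as a generalised element need not factor through one.
  | .sum ρ τ, W, x, y =>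
      ∀ (V : C) (h : V ⟶ W) (k₁ : V ⊗ A.ty ρ ⟶ ν.A) (κ₁ : V ⟶ A.tty ν (.neg ρ.cps))
        (k₂ : V ⊗ A.ty τ ⟶ ν.A) (κ₂ : V ⟶ A.tty ν (.neg τ.cps)),
        ContRel (LR ρ) k₁ κ₁ → ContRel (LR τ) k₂ κ₂ →
        lift (𝟙 V) (h ≫ x) ≫ copair k₁ k₂ =
          lift (𝟙 V) (h ≫ y) ≫ copair (X := A.tty ν ρ.cps) (Y := A.tty ν τ.cps)
            (Unlam κ₁) (Unlam κ₂)
  | .arr ρ τ, W, f, g =>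
      ∀ (V : C) (h : V ⟶ W) (x : V ⟶ A.ty ρ) (y : V ⟶ A.tty ν ρ.cps)
        (k : V ⊗ A.ty τ ⟶ ν.A) (κ : V ⟶ A.tty ν (.neg τ.cps)),
        LR ρ V x y → ContRel (LR τ) k κ →
        wpp ν (lift (h ≫ f) x ≫ Ev (A.ty ρ) (A.T.obj (A.ty τ))) k = ap (h ≫ g) (duo y κ)

variable {A ν}

/-- Kripke monotonicity: the clauses that observe answers already quantify over all later stages, so
`h` is absorbed into that quantifier. -/
theorem LR.comp : ∀ {ρ : Ty S.B} {V W : C} {x : W ⟶ A.ty ρ} {y : W ⟶ A.tty ν ρ.cps}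
    (_ : LR A ν ρ W x y) (h : V ⟶ W), LR A ν ρ V (h ≫ x) (h ≫ y)
  | .base b, V, W, x, y, hxy, h => by
    exact OmegaEq.precomp hxy h
  | .unit, _, _, _, _, _, _ => trivial
  | .zero, _, _, _, _, _, _ => trivial
  | .prod ρ τ, V, W, x, y, hxy, h => by
    exact ⟨(congrArg₂ (LR A ν ρ V) (Category.assoc h x _) (comp_p₁ h _).symm).mpr (hxy.1.comp h),
      (congrArg₂ (LR A ν τ V) (Category.assoc h x _) (comp_p₂ h _).symm).mpr (hxy.2.comp h)⟩
  | .sum ρ τ, V, W, x, y, hxy, h => by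
    intro U g k₁ κ₁ k₂ κ₂ hk₁ hk₂
    have := hxy U (g ≫ h) k₁ κ₁ k₂ κ₂ hk₁ hk₂
    rw [Category.assoc, Category.assoc] at this
    exact this
  | .arr ρ τ, V, W, f, g, hfg, h => by
    intro U g' x y k κ hxy hk
    refine Eq.trans ?_ ((hfg U (g' ≫ h) x y k κ hxy hk).trans ?_)
    · exact congrArg (fun t => wpp ν (lift t x ≫ Ev _ _) k) (Category.assoc _ _ _).symm
    · exact congrArg (fun t => ap t (duo y κ)) (Category.assoc _ _ _)

theorem ContRel.comp {ρ : Ty S.B} {R : ∀ W : C, (W ⟶ A.ty ρ) → (W ⟶ A.tty ν ρ.cps) → Prop}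
    {V W : C} {k : W ⊗ A.ty ρ ⟶ ν.A} {κ : W ⟶ A.tty ν (.neg ρ.cps)} (hk : ContRel R k κ)
    (h : V ⟶ W) : ContRel R ((h ▷ A.ty ρ) ≫ k) (h ≫ κ) := by
  intro U g x y hxy
  have := hk U (g ≫ h) x y hxy
  rw [Category.assoc] at this
  rw [← this, lift_whiskerRight_assoc]

/-! ## Ground types -/

theorem groundHom_prod {ρ τ : Ty S.B} (h : (Ty.prod ρ τ).IsGround) :
    A.groundHom ν h = (A.groundHom ν h.1 ⊗ₘ A.groundHom ν h.2 : A.ty ρ ⊗ A.ty τ ⟶ _) :=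
  eqToHom_congrArg₂_tensor _ _

theorem groundHom_sum {ρ τ : Ty S.B} (h : (Ty.sum ρ τ).IsGround) :
    A.groundHom ν h =
      (coprod.map (A.groundHom ν h.1) (A.groundHom ν h.2) : A.ty ρ ⨿ A.ty τ ⟶ _) :=
  eqToHom_congrArg₂_coprod _ _

theorem groundHom_groundInv {ρ : Ty S.B} (h : ρ.IsGround) :
    A.groundHom ν h ≫ A.groundInv ν h = 𝟙 _ := by
  simp [groundHom, groundInv]

theorem groundCtxHom_cons {Γ : List (Ty S.B)} {ρ : Ty S.B} (h : ∀ σ ∈ ρ :: Γ, σ.IsGround) :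
    A.groundCtxHom ν h =
      (A.groundCtxHom ν (fun σ hσ => h σ (List.mem_cons_of_mem ρ hσ)) ⊗ₘ
        A.groundHom ν (h ρ List.mem_cons_self) : A.ctx Γ ⊗ A.ty ρ ⟶ _) :=
  eqToHom_congrArg₂_tensor _ _

/-- On ground types, the logical relation is `Ω`-equivalence. -/
theorem LR_iff_omegaEq : ∀ {ρ : Ty S.B} (hρ : ρ.IsGround) {W : C} {x : W ⟶ A.ty ρ}
    {y : W ⟶ A.tty ν ρ.cps}, LR A ν ρ W x y ↔ OmegaEq ν.A (x ≫ A.groundHom ν hρ) y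
  | .base b, _, W, x, y => by
    have e : x ≫ A.groundHom ν (ρ := .base b) trivial = x := Category.comp_id _
    rw [e]
    exact Iff.rfl
  | .unit, _, W, x, y => by
    refine iff_of_true trivial ?_
    have e : x ≫ A.groundHom ν (ρ := .unit) trivial = y := toUnit_unique _ _
    rw [e]
    exact OmegaEq.refl _
  | .zero, _, W, x, y => by
    refine iff_of_true trivial ?_
    rw [eq_of_hom_initial x (x ≫ A.groundHom ν (ρ := .zero) trivial) y]
    exact OmegaEq.refl _
  | .prod ρ τ, h, W, x, y => by
    have e₁ : (x ≫ A.groundHom ν h) ≫ fst (A.tty ν ρ.cps) (A.tty ν τ.cps) =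
        (x ≫ fst (A.ty ρ) (A.ty τ)) ≫ A.groundHom ν h.1 := by
      rw [groundHom_prod]
      exact (Category.assoc _ _ _).trans
        ((congrArg (x ≫ ·) (tensorHom_fst _ _)).trans (Category.assoc _ _ _).symm)
    have e₂ : (x ≫ A.groundHom ν h) ≫ snd (A.tty ν ρ.cps) (A.tty ν τ.cps) =
        (x ≫ snd (A.ty ρ) (A.ty τ)) ≫ A.groundHom ν h.2 := by
      rw [groundHom_prod]
      exact (Category.assoc _ _ _).trans
        ((congrArg (x ≫ ·) (tensorHom_snd _ _)).trans (Category.assoc _ _ _).symm)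
    refine Iff.trans (and_congr (LR_iff_omegaEq h.1) (LR_iff_omegaEq h.2)) ?_
    rw [← e₁, ← e₂]
    exact ⟨fun H => OmegaEq.prod H.1 H.2, fun H => ⟨H.comp _, H.comp _⟩⟩
  | .sum ρ τ, h, W, x, y => by
    constructor
    · intro hxy V g (q : V ⊗ (A.tty ν ρ.cps ⨿ A.tty ν τ.cps) ⟶ ν.A)
      -- A test restricted to one summand gives a related pair: as a postcondition after the ground
      -- identification, and curried as a continuation. The induction hypothesis makes them agree.
      have hk {σ : Ty S.B} (hσ : σ.IsGround) (q' : V ⊗ A.tty ν σ.cps ⟶ ν.A)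
          (ih : ∀ {W : C} {x : W ⟶ A.ty σ} {y : W ⟶ A.tty ν σ.cps}, LR A ν σ W x y →
            OmegaEq ν.A (x ≫ A.groundHom ν hσ) y) :
          ContRel (LR A ν σ) ((V ◁ A.groundHom ν hσ) ≫ q') (Lam q') := by
        intro U g' x y hxy
        have := (ih hxy).test (𝟙 U) g' q'
        rw [Category.id_comp, Category.id_comp] at this
        rw [lift_whiskerLeft_assoc, this]
        exact (lift_Lam_Ev _ _ _).symm
      have := hxy V g _ _ _ _ (hk h.1 ((V ◁ coprod.inl) ≫ q) (LR_iff_omegaEq h.1).1)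
        (hk h.2 ((V ◁ coprod.inr) ≫ q) (LR_iff_omegaEq h.2).1)
      rw [copair_whiskerLeft, Unlam_Lam, Unlam_Lam, copair_eta] at this
      rw [groundHom_sum]
      exact (lift_comp_comp _ _ _ _ _).trans this
    · intro hxy V g k₁ κ₁ k₂ κ₂ hk₁ hk₂
      -- Conversely, a related pair comes from a single test: evaluating both at the generic element
      -- `snd` determines `k` from `κ`.
      have hk {σ : Ty S.B} (hσ : σ.IsGround) {k : V ⊗ A.ty σ ⟶ ν.A}
          {κ : V ⟶ A.tty ν (.neg σ.cps)} (hk : ContRel (LR A ν σ) k κ)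
          (ih : ∀ {W : C} {x : W ⟶ A.ty σ} {y : W ⟶ A.tty ν σ.cps},
            OmegaEq ν.A (x ≫ A.groundHom ν hσ) y → LR A ν σ W x y) :
          k = (V ◁ A.groundHom ν hσ) ≫ Unlam (Y := A.tty ν σ.cps) κ := by
        have := hk _ (fst _ _) (snd _ _) (snd V (A.ty σ) ≫ A.groundHom ν hσ)
          (ih (OmegaEq.refl _))
        rw [lift_fst_snd, Category.id_comp] at this
        rw [this]
        have e : V ◁ A.groundHom ν hσ = lift (fst V (A.ty σ)) (snd V (A.ty σ) ≫ A.groundHom ν hσ) := by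
          ext <;> simp
        rw [e]
        exact (lift_Unlam _ _ _).symm
      rw [hk h.1 hk₁ (LR_iff_omegaEq h.1).2, hk h.2 hk₂ (LR_iff_omegaEq h.2).2,
        copair_whiskerLeft]
      rw [groundHom_sum] at hxy
      exact (lift_comp_comp _ _ _ _ _).symm.trans (hxy V g _)

theorem LR_groundHom {ρ : Ty S.B} (hρ : ρ.IsGround) {W : C} (x : W ⟶ A.ty ρ) :
    LR A ν ρ W x (x ≫ A.groundHom ν hρ) :=
  (LR_iff_omegaEq hρ).2 (OmegaEq.refl _)

end Str

end

section

variable {C : Type u} [Category.{v} C] [CartesianMonoidalCategory C] [MonoidalClosed C]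
  [HasInitial C] [HasBinaryCoproducts C] {S : Sig.{a, b, c}} {A : Str S C}
  {ν : A.T.toMonad.Algebra}

namespace Str

/-! ## The fundamental lemma -/

variable (A ν) in
/-- Environments are related if they map each variable to related values. -/
def EnvRel {Γ : List (Ty S.B)} {W : C} (γ : W ⟶ A.ctx Γ) (γ' : W ⟶ A.tctx ν (Γ.map Ty.cps)) :
    Prop :=
  ∀ (ρ : Ty S.B) (x : Var Γ ρ),
    LR A ν ρ W (γ ≫ x.proj A.ty) (γ' ≫ A.tsem ν (.var (x.map Ty.cps)))

variable {Γ : List (Ty S.B)} {ρ τ : Ty S.B} {V W : C}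

/-- The weakest precondition of `f` is itself a test on the argument of `f`. -/
theorem _root_.LambdaC.OmegaEq.wpp_congr {X Y : C} {x y : W ⟶ X} (h : OmegaEq ν.A x y)
    (f : X ⟶ A.T.obj Y) (q : W ⊗ Y ⟶ ν.A) : wpp ν (x ≫ f) q = wpp ν (y ≫ f) q := by
  have := h W (𝟙 W) (wpp ν (snd W X ≫ f) ((fst W X ▷ Y) ≫ q))
  rw [lift_wpp_snd, lift_wpp_snd] at this
  simpa using this

theorem EnvRel.comp {γ : W ⟶ A.ctx Γ} {γ' : W ⟶ A.tctx ν (Γ.map Ty.cps)}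
    (hγ : EnvRel A ν γ γ') (h : V ⟶ W) : EnvRel A ν (h ≫ γ) (h ≫ γ') := by
  intro ρ x
  have := (hγ ρ x).comp h
  rwa [← Category.assoc, ← Category.assoc] at this

theorem EnvRel.cons {γ : W ⟶ A.ctx Γ} {γ' : W ⟶ A.tctx ν (Γ.map Ty.cps)}
    (hγ : EnvRel A ν γ γ') {x : W ⟶ A.ty ρ} {y : W ⟶ A.tty ν ρ.cps} (hxy : LR A ν ρ W x y) :
    EnvRel A ν (Γ := ρ :: Γ) (lift γ x) (snoc γ' y) := by
  intro σ z
  cases z with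
  | z =>
    exact (congrArg₂ (LR A ν ρ W) (lift_snd _ _) (snoc_tsem_var_zero _ _)).mpr hxy
  | s z =>
    exact (congrArg₂ (LR A ν σ W) (lift_fst_assoc _ _ _)
      (snoc_tsem_var_succ _ _ _)).mpr (hγ σ z)

theorem LR.pair {x : W ⟶ A.ty ρ} {y : W ⟶ A.tty ν ρ.cps} {x' : W ⟶ A.ty τ}
    {y' : W ⟶ A.tty ν τ.cps} (h : LR A ν ρ W x y) (h' : LR A ν τ W x' y') :
    LR A ν (.prod ρ τ) W (lift x x') (duo y y') :=
  ⟨(congrArg₂ (LR A ν ρ W) (lift_fst _ _) (p₁_duo _ _)).mpr h,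
    (congrArg₂ (LR A ν τ W) (lift_snd _ _) (p₂_duo _ _)).mpr h'⟩

theorem LR.inl {x : W ⟶ A.ty ρ} {y : W ⟶ A.tty ν ρ.cps} (h : LR A ν ρ W x y) :
    LR A ν (.sum ρ τ) W (x ≫ (coprod.inl : A.ty ρ ⟶ A.ty ρ ⨿ A.ty τ)) (i₁ y) := by
  intro V g k₁ κ₁ k₂ κ₂ hk₁ _
  have e {X Y Z : C} (x : W ⟶ X) (f : V ⊗ X ⟶ Z) (f' : V ⊗ Y ⟶ Z) :
      lift (𝟙 V) (g ≫ x ≫ coprod.inl) ≫ copair f f' = lift (𝟙 V) (g ≫ x) ≫ f := by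
    rw [← Category.assoc, lift_inl_copair]
  refine (e _ _ _).trans (Eq.trans ?_ (e _ _ _).symm)
  exact (hk₁ V (𝟙 V) _ _ (h.comp g)).trans (lift_Unlam _ _ _).symm

theorem LR.inr {x : W ⟶ A.ty τ} {y : W ⟶ A.tty ν τ.cps} (h : LR A ν τ W x y) :
    LR A ν (.sum ρ τ) W (x ≫ (coprod.inr : A.ty τ ⟶ A.ty ρ ⨿ A.ty τ)) (i₂ y) := by
  intro V g k₁ κ₁ k₂ κ₂ _ hk₂
  have e {X Y Z : C} (x : W ⟶ Y) (f : V ⊗ X ⟶ Z) (f' : V ⊗ Y ⟶ Z) :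
      lift (𝟙 V) (g ≫ x ≫ coprod.inr) ≫ copair f f' = lift (𝟙 V) (g ≫ x) ≫ f' := by
    rw [← Category.assoc, lift_inr_copair]
  refine (e _ _ _).trans (Eq.trans ?_ (e _ _ _).symm)
  exact (hk₂ V (𝟙 V) _ _ (h.comp g)).trans (lift_Unlam _ _ _).symm

theorem LR.omegaEq_groundInv (hρ : ρ.IsGround) {x : W ⟶ A.ty ρ} {y : W ⟶ A.tty ν ρ.cps}
    (h : LR A ν ρ W x y) : OmegaEq ν.A x (y ≫ A.groundInv ν hρ) := by
  have := ((LR_iff_omegaEq hρ).1 h).comp (A.groundInv ν hρ)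
  rwa [Category.assoc, groundHom_groundInv, Category.comp_id] at this

/-- `Ω`-equivalence is stable under postcomposition with any morphism, in particular with the
interpretation of a constant. -/
theorem LR.const (k : S.K) {x : W ⟶ A.ty (S.arK k)} {y : W ⟶ A.tty ν (S.arK k).cps}
    (h : LR A ν _ W x y) :
    LR A ν _ W (x ≫ A.const k)
      (y ≫ A.groundInv ν (S.arK_ground k) ≫ A.const k ≫ A.groundHom ν (S.carK_ground k)) := by
  rw [LR_iff_omegaEq (S.carK_ground k)]
  have := (h.omegaEq_groundInv (S.arK_ground k)).comp (A.const k ≫ A.groundHom ν (S.carK_ground k))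
  rwa [Category.assoc, ← Category.assoc x] at this

theorem modal_eq_wpp (o : S.O) (f : W ⟶ A.tty ν (.neg (S.arO o).cps))
    (x : W ⟶ A.tty ν (S.carO o).cps) :
    modal o f x = wpp ν (x ≫ A.groundInv ν (S.carO_ground o) ≫ (A.op o).gef)
      (ap (fst W (A.ty (S.arO o)) ≫ f) (snd _ _ ≫ A.groundHom ν (S.arO_ground o))) := by
  have key {X Y Z : C} (f : W ⟶ (ihom Z).obj ν.A) (m : W ⟶ A.T.obj Y) (g : Y ⟶ Z) :
      lift f (m ≫ A.T.map g) ≫ A.T.str _ _ ≫ A.T.map (Ev Z ν.A) ≫ ν.a =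
        wpp ν m (lift (fst W Y ≫ f) (snd W Y ≫ g) ≫ Ev Z ν.A) := by
    have h := lift_str (T := A.T) (𝟙 W) (m ≫ A.T.map g) f
    have e : lift (fst W Y ≫ f) (snd W Y ≫ g) = (W ◁ g) ≫ (f ▷ Z) := by ext <;> simp
    rw [Category.id_comp] at h
    rw [e, Category.assoc, ← wpp_map, wpp, Functor.map_comp, Category.assoc, reassoc_of% h]
  have e : x ≫ A.groundInv ν (S.carO_ground o) ≫ (A.op o).gef ≫
      A.T.map (A.groundHom ν (S.arO_ground o)) =
      (x ≫ A.groundInv ν (S.carO_ground o) ≫ (A.op o).gef) ≫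
        A.T.map (A.groundHom ν (S.arO_ground o)) := by
    simp only [Category.assoc]
  rw [modal, e]
  exact key (X := A.ty (S.arO o)) _ _ _

/-- Both sides are weakest preconditions of the generic effect. Their postconditions agree because
the function components are related and can be tried on the generic arity element; their coarity
arguments are `Ω`-equivalent, which `wpp` cannot detect. The target continuation `f` matters only
through its applications. -/
theorem LR.op (o : S.O) {x : W ⟶ A.ty (.prod (.arr (S.arO o) ρ) (S.carO o))}
    {y : W ⟶ A.tty ν (.prod (.neg (.prod (S.arO o).cps (.neg ρ.cps))) (S.carO o).cps)}
    (hxy : LR A ν (.prod (.arr (S.arO o) ρ) (S.carO o)) W x y)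
    {k : W ⊗ A.ty ρ ⟶ ν.A} {κ : W ⟶ A.tty ν (.neg ρ.cps)} (hk : ContRel (LR A ν ρ) k κ)
    {f : W ⟶ A.tty ν (.neg (S.arO o).cps)}
    (hf : ∀ (V : C) (h : V ⟶ W) (z : V ⟶ A.tty ν (S.arO o).cps),
      ap (h ≫ f) z = ap (h ≫ p₁ y) (duo z (h ≫ κ))) :
    wpp ν (x ≫ Unlam ((A.op o).app (A.ty ρ))) k = modal o f (p₂ y) := by
  have e : x = lift (Y := A.ty (S.carO o))
      (x ≫ fst (A.ty (.arr (S.arO o) ρ)) (A.ty (S.carO o)))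
      (x ≫ snd (A.ty (.arr (S.arO o) ρ)) (A.ty (S.carO o))) :=
    (lift_comp_fst_snd _).symm
  -- The relation of the function components, at the stage extended by a generic element of the
  -- arity.
  have e₁ := hxy.1 _ (fst W (A.ty (S.arO o))) (snd _ _)
    (snd _ _ ≫ A.groundHom ν (S.arO_ground o)) _ _ (LR_groundHom _ _)
    (hk.comp (fst W (A.ty (S.arO o))))
  rw [modal_eq_wpp, hf, e]
  refine (wpp_algOp ν (A.op o) _ _ k).trans ?_
  refine Eq.trans (congrArg (wpp ν _) e₁) ?_
  set q := ap (fst W (A.ty (S.arO o)) ≫ p₁ y)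
    (duo (snd W (A.ty (S.arO o)) ≫ A.groundHom ν (S.arO_ground o)) (fst W _ ≫ κ))
  exact ((hxy.2.omegaEq_groundInv (S.carO_ground o)).wpp_congr (A.op o).gef q).trans
    (congrArg (wpp ν · q) (Category.assoc _ _ _))

end Str

end

section

variable {C : Type u} [Category.{v} C] [CartesianMonoidalCategory C] [MonoidalClosed C]
  [HasInitial C] [HasBinaryCoproducts C] {S : Sig.{a, b, c}} {A : Str S C}
  {ν : A.T.toMonad.Algebra}

namespace Str

/-! ### Evaluation of the continuations of the CPS transformation -/

section Target

variable {Δ : List (TTy S.B)} {α β ζ : TTy S.B} {V W : C} (e : W ⟶ A.tctx ν Δ)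
  (κ : W ⟶ A.tty ν (.neg α)) (h : V ⟶ W)

theorem ap_cps_bind (M : TTm S Δ (.neg (.neg β))) (K : TTm S (.neg α :: Δ) (.neg β)) :
    ap (e ≫ A.tsem ν (.lam (.app (M.wk _) K))) κ =
      ap (e ≫ A.tsem ν M) (snoc e κ ≫ A.tsem ν K) := by
  rw [ap_tsem_lam, comp_tsem_app, snoc_tsem_wk]

theorem ap_cps_return (N : TTm S (.neg α :: Δ) α) :
    ap (e ≫ A.tsem ν (.lam (.app (.var .z) N))) κ = ap κ (snoc e κ ≫ A.tsem ν N) := by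
  rw [ap_tsem_lam, comp_tsem_app, snoc_tsem_var_zero]

theorem ap_cps_lam (K : TTm S (β :: .neg α :: Δ) .R) (y : V ⟶ A.tty ν β) :
    ap (h ≫ snoc e κ ≫ A.tsem ν (.lam K)) y = snoc (snoc (h ≫ e) (h ≫ κ)) y ≫ A.tsem ν K := by
  rw [← Category.assoc, comp_snoc, ap_tsem_lam]

theorem ap_cps_map (N : TTm S (β :: .neg α :: Δ) α) (y : V ⟶ A.tty ν β) :
    ap (h ≫ snoc e κ ≫ A.tsem ν (.lam (.app (.var (.s .z)) N))) y =
      ap (h ≫ κ) (snoc (snoc (h ≫ e) (h ≫ κ)) y ≫ A.tsem ν N) := by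
  rw [ap_cps_lam, comp_tsem_app, snoc_tsem_var_succ, snoc_tsem_var_zero]

theorem ap_cps_fst (y : V ⟶ A.tty ν (.prod α β)) :
    ap (h ≫ snoc e κ ≫ A.tsem ν (.lam (.app (.var (.s .z)) (.fst (.var .z))))) y =
      ap (h ≫ κ) (p₁ y) := by
  rw [ap_cps_map, comp_tsem_fst, snoc_tsem_var_zero]

theorem ap_cps_snd (y : V ⟶ A.tty ν (.prod β α)) :
    ap (h ≫ snoc e κ ≫ A.tsem ν (.lam (.app (.var (.s .z)) (.snd (.var .z))))) y =
      ap (h ≫ κ) (p₂ y) := by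
  rw [ap_cps_map, comp_tsem_snd, snoc_tsem_var_zero]

theorem ap_cps_inl (κ : W ⟶ A.tty ν (.neg (.sum α β))) (y : V ⟶ A.tty ν α) :
    ap (h ≫ snoc e κ ≫ A.tsem ν (.lam (.app (.var (.s .z)) (.inl (.var .z))))) y =
      ap (h ≫ κ) (i₁ y) := by
  rw [ap_cps_map, comp_tsem_inl, snoc_tsem_var_zero]

theorem ap_cps_inr (κ : W ⟶ A.tty ν (.neg (.sum α β))) (y : V ⟶ A.tty ν β) :
    ap (h ≫ snoc e κ ≫ A.tsem ν (.lam (.app (.var (.s .z)) (.inr (.var .z))))) y =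
      ap (h ≫ κ) (i₂ y) := by
  rw [ap_cps_map, comp_tsem_inr, snoc_tsem_var_zero]

theorem ap_cps_second (N : TTm S Δ (.neg (.neg ζ))) (K : TTm S (β :: .neg α :: Δ) (.neg ζ))
    (y : V ⟶ A.tty ν β) :
    ap (h ≫ snoc e κ ≫ A.tsem ν (.lam (.app ((N.wk _).wk _) K))) y =
      ap (h ≫ e ≫ A.tsem ν N) (snoc (snoc (h ≫ e) (h ≫ κ)) y ≫ A.tsem ν K) := by
  rw [ap_cps_lam, comp_tsem_app, snoc_tsem_wk, snoc_tsem_wk, Category.assoc]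

theorem ap_cps_pair {U : C} (κ : W ⟶ A.tty ν (.neg (.prod α β))) (g : U ⟶ V)
    (y : V ⟶ A.tty ν α) (z : U ⟶ A.tty ν β) :
    ap (g ≫ snoc (snoc (h ≫ e) (h ≫ κ)) y ≫ A.tsem ν
      (.lam (.app (.var (.s (.s .z))) (.pair (.var (.s .z)) (.var .z))))) z =
      ap ((g ≫ h) ≫ κ) (duo (g ≫ y) z) := by
  rw [← Category.assoc, comp_snoc, comp_snoc, ap_tsem_lam, comp_tsem_app, comp_tsem_pair]
  simp only [snoc_tsem_var_succ, snoc_tsem_var_zero, Category.assoc]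

theorem ap_cps_app {U : C} (g : U ⟶ V) (y : V ⟶ A.tty ν (.neg (.prod β (.neg α))))
    (z : U ⟶ A.tty ν β) :
    ap (g ≫ snoc (snoc (h ≫ e) (h ≫ κ)) y ≫ A.tsem ν
      (.lam (.app (.var (.s .z)) (.pair (.var .z) (.var (.s (.s .z))))))) z =
      ap (g ≫ y) (duo z ((g ≫ h) ≫ κ)) := by
  rw [← Category.assoc, comp_snoc, comp_snoc, ap_tsem_lam, comp_tsem_app, comp_tsem_pair]
  simp only [snoc_tsem_var_succ, snoc_tsem_var_zero, Category.assoc]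

theorem ap_cps_abs {σ : TTy S.B} (κ : W ⟶ A.tty ν σ)
    (M : TTm S (α :: Δ) (.neg (.neg β))) (y : V ⟶ A.tty ν α)
    (κ' : V ⟶ A.tty ν (.neg β)) :
    ap (h ≫ snoc e κ ≫ A.tsem ν (.plam
      (.app ((M.rename (Ren.lift (fun _ x => .s x) _)).wk _) (.var .z)))) (duo y κ') =
      ap (snoc (h ≫ e) y ≫ A.tsem ν M) κ' := by
  rw [← Category.assoc, comp_snoc, ap_tsem_plam, p₁_duo, p₂_duo, comp_tsem_app, snoc_tsem_wk,
    snoc_tsem_rename_lift_wk, snoc_tsem_var_zero]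

theorem ap_cps_op (o : S.O)
    (y : V ⟶ A.tty ν (.prod (.neg (.prod (S.arO o).cps (.neg α))) (S.carO o).cps)) :
    ∃ f : V ⟶ A.tty ν (.neg (S.arO o).cps),
      (∀ (U : C) (g : U ⟶ V) (z : U ⟶ A.tty ν (S.arO o).cps),
        ap (g ≫ f) z = ap (g ≫ p₁ y) (duo z (g ≫ h ≫ κ))) ∧
      ap (h ≫ snoc e κ ≫ A.tsem ν (.plam (.op o (.pair
        (.lam (.app (.var (.s (.s .z))) (.pair (.var .z) (.var (.s (.s (.s .z)))))))
        (.var .z))))) y = modal o f (p₂ y) := by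
  refine ⟨snoc (snoc (snoc (h ≫ e) (h ≫ κ)) (p₁ y)) (p₂ y) ≫ A.tsem ν
    (.lam (.app (.var (.s (.s .z))) (.pair (.var .z) (.var (.s (.s (.s .z))))))),
    fun U g z => ?_, ?_⟩
  · rw [← Category.assoc, comp_snoc, comp_snoc, comp_snoc, ap_tsem_lam, comp_tsem_app,
      comp_tsem_pair]
    simp only [snoc_tsem_var_succ, snoc_tsem_var_zero]
  · rw [← Category.assoc, comp_snoc, ap_tsem_plam, comp_tsem_op, comp_tsem_pair, p₁_duo, p₂_duo,
      snoc_tsem_var_zero]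

/-- The branch of a case analysis in the CPS transformation. -/
def branch (N : TTm S (β :: Δ) (.neg (.neg α))) : V ⊗ A.tty ν β ⟶ ν.A :=
  ap (snoc (fst V (A.tty ν β) ≫ h ≫ e) (snd V (A.tty ν β)) ≫ A.tsem ν N)
    (fst V (A.tty ν β) ≫ h ≫ κ)

theorem lift_branch (N : TTm S (β :: Δ) (.neg (.neg α))) {U : C} (g : U ⟶ V)
    (z : U ⟶ A.tty ν β) :
    lift g z ≫ branch e κ h N = ap (snoc (g ≫ h ≫ e) z ≫ A.tsem ν N) (g ≫ h ≫ κ) := by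
  refine (comp_ap _ _ _).trans ?_
  rw [← Category.assoc, comp_snoc, lift_fst_assoc, lift_fst_assoc, lift_snd]

theorem ap_cps_case {β' : TTy S.B} (N₁ : TTm S (β :: Δ) (.neg (.neg α)))
    (N₂ : TTm S (β' :: Δ) (.neg (.neg α))) (y : V ⟶ A.tty ν (.sum β β')) :
    ap (h ≫ snoc e κ ≫ A.tsem ν (.lam (.case (.var .z)
      (.app (N₁.rename (Ren.lift (fun _ x => .s (.s x)) _)) (.var (.s (.s .z))))
      (.app (N₂.rename (Ren.lift (fun _ x => .s (.s x)) _)) (.var (.s (.s .z))))))) y =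
      lift (𝟙 V) y ≫ copair (X := A.tty ν β) (Y := A.tty ν β')
        (branch e κ h N₁) (branch e κ h N₂) := by
  have hb {ζ : TTy S.B} (N : TTm S (ζ :: Δ) (.neg (.neg α))) :
      (snoc (snoc (h ≫ e) (h ≫ κ)) y ▷ A.tty ν ζ) ≫ A.tsem ν
        (.app (N.rename (Ren.lift (fun _ x => .s (.s x)) _)) (.var (.s (.s .z)))) =
      branch e κ h N := by
    have e' {X Y Z : C} (f : V ⟶ X) (r : X ⊗ Y ⟶ Z) :
        (f ▷ Y) ≫ r = lift (fst V Y ≫ f) (snd V Y) ≫ r := by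
      congr 1
      ext <;> simp
    refine (e' _ _).trans ?_
    refine (comp_tsem_app (snoc (fst V (A.tty ν ζ) ≫ _) (snd V (A.tty ν ζ))) _ _).trans ?_
    rw [comp_snoc, comp_snoc, snoc_tsem_rename_lift_wk_wk]
    simp only [snoc_tsem_var_succ, snoc_tsem_var_zero]
    rfl
  rw [ap_cps_lam]
  exact (comp_tsem_case A ν _ _ _ _).trans
    (lift_copair_congr (snoc_tsem_var_zero _ _) (hb N₁) (hb N₂))

theorem ap_lam_weakenCtx (P : TTm S [α] .R) (y : W ⟶ A.tty ν α) :
    ap (e ≫ A.tsem ν (.lam (P.weakenCtx Δ))) y =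
      snoc (Γ := []) (toUnit W) y ≫ A.tsem ν P := by
  let r : A.tctx ν (α :: Δ) ⟶ A.tctx ν [] := toUnit _
  let t : A.tctx ν (α :: Δ) ⟶ A.tty ν α := snd (A.tctx ν Δ) (A.tty ν α)
  rw [ap_tsem_lam, TTm.weakenCtx, tsem_rename A ν P _ (snoc r t), ← Category.assoc, comp_snoc]
  · exact congrArg₂ (fun a b => snoc (Γ := []) a b ≫ A.tsem ν P) (toUnit_unique _ _)
      (lift_snd _ _)
  · intro σ z
    cases z with
    | z => exact (lift_snd _ _).symm
    | s z => nomatch z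

end Target

variable (A ν) in
/-- A source term satisfies the fundamental lemma if, in related environments, its weakest
precondition of a postcondition agrees with its CPS transform applied to a related continuation. -/
def TermRel {Γ : List (Ty S.B)} {ρ : Ty S.B} (M : Tm S Γ ρ) : Prop :=
  ∀ (W : C) (γ : W ⟶ A.ctx Γ) (γ' : W ⟶ A.tctx ν (Γ.map Ty.cps)) (k : W ⊗ A.ty ρ ⟶ ν.A)
    (κ : W ⟶ A.tty ν (.neg ρ.cps)), EnvRel A ν γ γ' → ContRel (LR A ν ρ) k κ →
    wpp ν (γ ≫ A.sem M) k = ap (γ' ≫ A.tsem ν M.cps) κ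

/-! ### The term formers in the fundamental lemma -/

variable {Γ : List (Ty S.B)} {ρ τ : Ty S.B}

theorem TermRel.var (x : Var Γ ρ) : TermRel A ν (.var x : Tm S Γ ρ) := by
  intro W γ γ' k κ hγ hk
  rw [Tm.cps, ap_tsem_lam, comp_tsem_app, snoc_tsem_var_zero, snoc_tsem_var_succ, sem,
    ← Category.assoc, wpp_unit]
  simpa only [Category.id_comp] using hk W (𝟙 W) _ _ (hγ ρ x)

theorem TermRel.unit : TermRel A ν (.unit : Tm S Γ .unit) := by
  intro W γ γ' k κ hγ hk
  refine Eq.trans ?_ (ap_cps_return γ' κ .unit).symm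
  have h := hk W (𝟙 W) (γ ≫ toUnit _) (snoc γ' κ ≫ A.tsem ν .unit) trivial
  rw [Category.id_comp] at h
  refine Eq.trans ?_ h
  exact (congrArg (wpp ν · k) (Category.assoc _ _ _).symm).trans (wpp_unit ν _ _)

/-- The clauses of the semantics that apply a morphism to the value of a term. -/
theorem wpp_comp_map {W X Y Z : C} (γ : W ⟶ X) (m : X ⟶ A.T.obj Y) (f : Y ⟶ Z)
    (k : W ⊗ Z ⟶ ν.A) : wpp ν (γ ≫ m ≫ A.T.map f) k = wpp ν (γ ≫ m) ((W ◁ f) ≫ k) := by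
  rw [← Category.assoc, wpp_map]

theorem TermRel.const (k : S.K) {M : Tm S Γ (S.arK k)} (ih : TermRel A ν M) :
    TermRel A ν (.const k M) := by
  intro W γ γ' q κ hγ hq
  refine Eq.trans ?_ (ap_cps_bind γ' κ _ _).symm
  refine (wpp_comp_map γ _ _ _).trans (ih W γ γ' _ _ hγ ?_)
  intro V h x y hxy
  rw [lift_whiskerLeft_assoc, ap_cps_map, comp_tsem_const, snoc_tsem_var_zero]
  exact hq V h _ _ hxy.const

theorem TermRel.fst {M : Tm S Γ (.prod ρ τ)} (ih : TermRel A ν M) : TermRel A ν (.fst M) := by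
  intro W γ γ' q κ hγ hq
  refine Eq.trans ?_ (ap_cps_bind γ' κ _ _).symm
  refine (wpp_comp_map γ _ _ _).trans (ih W γ γ' _ _ hγ ?_)
  intro V h x y hxy
  exact (lift_whiskerLeft_assoc _ _ _ _).trans
    ((hq V h _ _ hxy.1).trans (ap_cps_fst γ' κ h y).symm)

theorem TermRel.snd {M : Tm S Γ (.prod ρ τ)} (ih : TermRel A ν M) : TermRel A ν (.snd M) := by
  intro W γ γ' q κ hγ hq
  refine Eq.trans ?_ (ap_cps_bind γ' κ _ _).symm
  refine (wpp_comp_map γ _ _ _).trans (ih W γ γ' _ _ hγ ?_)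
  intro V h x y hxy
  exact (lift_whiskerLeft_assoc _ _ _ _).trans
    ((hq V h _ _ hxy.2).trans (ap_cps_snd γ' κ h y).symm)

theorem TermRel.absurd {M : Tm S Γ .zero} (ih : TermRel A ν M) :
    TermRel A ν (.absurd M : Tm S Γ ρ) := by
  intro W γ γ' q κ hγ hq
  refine Eq.trans ?_ (ap_cps_bind γ' κ _ _).symm
  refine (wpp_comp_map γ _ _ _).trans (ih W γ γ' _ _ hγ ?_)
  intro V h x y hxy
  exact eq_of_hom_initial x _ _

theorem TermRel.inl {M : Tm S Γ ρ} (ih : TermRel A ν M) :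
    TermRel A ν (.inl M : Tm S Γ (.sum ρ τ)) := by
  intro W γ γ' q κ hγ hq
  refine Eq.trans ?_ (ap_cps_bind γ' κ _ _).symm
  refine (wpp_comp_map γ _ _ _).trans (ih W γ γ' _ _ hγ ?_)
  intro V h x y hxy
  exact (lift_whiskerLeft_assoc _ _ _ _).trans
    ((hq V h _ _ hxy.inl).trans (ap_cps_inl γ' h κ y).symm)

theorem TermRel.inr {M : Tm S Γ τ} (ih : TermRel A ν M) :
    TermRel A ν (.inr M : Tm S Γ (.sum ρ τ)) := by
  intro W γ γ' q κ hγ hq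
  refine Eq.trans ?_ (ap_cps_bind γ' κ _ _).symm
  refine (wpp_comp_map γ _ _ _).trans (ih W γ γ' _ _ hγ ?_)
  intro V h x y hxy
  exact (lift_whiskerLeft_assoc _ _ _ _).trans
    ((hq V h _ _ hxy.inr).trans (ap_cps_inr γ' h κ y).symm)

theorem wpp_comp_mul_map {W X Y Z : C} (γ : W ⟶ X) (m : X ⟶ A.T.obj Y) (f : Y ⟶ A.T.obj Z)
    (k : W ⊗ Z ⟶ ν.A) : wpp ν (γ ≫ m ≫ A.T.map f ≫ A.T.μ.app Z) k =
      wpp ν (γ ≫ m) (wpp ν (snd W Y ≫ f) ((fst W Y ▷ Z) ≫ k)) := by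
  rw [← Category.assoc, wpp_mul_map]

theorem TermRel.op (o : S.O) {M : Tm S Γ (.prod (.arr (S.arO o) ρ) (S.carO o))}
    (ih : TermRel A ν M) : TermRel A ν (.op o ρ M) := by
  intro W γ γ' q κ hγ hq
  refine Eq.trans ?_ (ap_cps_bind γ' κ _ _).symm
  refine (wpp_comp_mul_map γ _ _ _).trans (ih W γ γ' _ _ hγ ?_)
  intro V h x y hxy
  obtain ⟨f, hf, e⟩ := ap_cps_op γ' κ h o y
  exact (lift_wpp_snd ν h x _ q).trans ((hxy.op o (hq.comp h) hf).trans e.symm)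

/-- Evaluation of two terms from left to right. -/
theorem TermRel.dstr {M : Tm S Γ ρ} {N : Tm S Γ τ} (ihM : TermRel A ν M) (ihN : TermRel A ν N)
    {W : C} {γ : W ⟶ A.ctx Γ} {γ' : W ⟶ A.tctx ν (Γ.map Ty.cps)} (hγ : EnvRel A ν γ γ')
    {k : W ⊗ (A.ty ρ ⊗ A.ty τ) ⟶ ν.A} {κ : W ⟶ A.tty ν (.neg ρ.cps)}
    {κ' : ∀ {V : C}, (V ⟶ W) → (V ⟶ A.tty ν ρ.cps) → (V ⟶ A.tty ν (.neg τ.cps))}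
    (h₁ : ∀ {V : C} (h : V ⟶ W) (y : V ⟶ A.tty ν ρ.cps),
      ap (h ≫ κ) y = ap (h ≫ γ' ≫ A.tsem ν N.cps) (κ' h y))
    (h₂ : ∀ {U V : C} (h : V ⟶ W) (g : U ⟶ V) (x : V ⟶ A.ty ρ) (y : V ⟶ A.tty ν ρ.cps)
      (x' : U ⟶ A.ty τ) (y' : U ⟶ A.tty ν τ.cps), LR A ν ρ V x y → LR A ν τ U x' y' →
      lift (g ≫ h) (lift (g ≫ x) x') ≫ k = ap (g ≫ κ' h y) y') :
    wpp ν (γ ≫ lift (A.sem M) (A.sem N) ≫ dstr A.T _ _) k = ap (γ' ≫ A.tsem ν M.cps) κ := by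
  rw [← Category.assoc, comp_lift, wpp_dstr]
  refine ihM W γ γ' _ κ hγ ?_
  intro V h x y hxy
  rw [comp_wpp, lift_fst_assoc, h₁, ← Category.assoc, ← Category.assoc h]
  refine ihN V _ _ _ _ (hγ.comp h) ?_
  intro U g x' y' hxy'
  rw [← h₂ h g x y x' y' hxy hxy', lift_whiskerRight_assoc, ← Category.assoc]
  congr 1
  ext <;> simp

theorem TermRel.pair {M : Tm S Γ ρ} {N : Tm S Γ τ} (ihM : TermRel A ν M)
    (ihN : TermRel A ν N) : TermRel A ν (.pair M N) := by
  intro W γ γ' q κ hγ hq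
  refine Eq.trans ?_ (ap_cps_bind γ' κ _ _).symm
  refine ihM.dstr ihN hγ (κ' := fun h y => snoc (snoc (h ≫ γ') (h ≫ κ)) y ≫ A.tsem ν
    (.lam (.app (.var (.s (.s .z))) (.pair (.var (.s .z)) (.var .z))))) ?_ ?_
  · exact fun h y => ap_cps_second γ' κ h N.cps _ y
  · intro U V h g x y x' y' hxy hxy'
    exact (hq U (g ≫ h) _ _ ((hxy.comp g).pair hxy')).trans (ap_cps_pair γ' h κ g y y').symm

theorem TermRel.app {M : Tm S Γ (.arr ρ τ)} {N : Tm S Γ ρ} (ihM : TermRel A ν M)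
    (ihN : TermRel A ν N) : TermRel A ν (.app M N) := by
  intro W γ γ' q κ hγ hq
  refine Eq.trans ?_ (ap_cps_bind γ' κ _ _).symm
  have e {X Y Z U : C} (m : A.ctx Γ ⟶ X) (d : X ⟶ A.T.obj Y) (f : Y ⟶ A.T.obj Z)
      (k : W ⊗ Z ⟶ ν.A) : wpp ν (γ ≫ m ≫ d ≫ A.T.map f ≫ A.T.μ.app Z) k =
      wpp ν (γ ≫ m ≫ d) (wpp ν (CartesianMonoidalCategory.snd W Y ≫ f)
        ((CartesianMonoidalCategory.fst W Y ▷ Z) ≫ k)) := by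
    rw [← Category.assoc m, wpp_comp_mul_map]
  refine (e (U := W) _ _ _ _).trans ?_
  refine ihM.dstr ihN hγ (κ' := fun h y => snoc (snoc (h ≫ γ') (h ≫ κ)) y ≫ A.tsem ν
    (.lam (.app (.var (.s .z)) (.pair (.var .z) (.var (.s (.s .z))))))) ?_ ?_
  · exact fun h y => ap_cps_second γ' κ h N.cps _ y
  · intro U V h g x y x' y' hxy hxy'
    refine (lift_wpp_snd ν _ _ _ q).trans ?_
    exact (hxy U g x' y' _ _ hxy' (hq.comp (g ≫ h))).trans (ap_cps_app γ' κ h g y y').symm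

theorem TermRel.lam {M : Tm S (ρ :: Γ) τ} (ih : TermRel A ν M) : TermRel A ν (.lam M) := by
  intro W γ γ' q κ hγ hq
  refine Eq.trans ?_ (ap_cps_return γ' κ _).symm
  -- The arrow clause at an abstraction is the induction hypothesis in the environment extended by
  -- the related arguments.
  have hx : LR A ν (.arr ρ τ) W (γ ≫ Lam (A.sem M)) (snoc γ' κ ≫ A.tsem ν (.plam
      (.app ((M.cps.rename (Ren.lift (fun _ x => .s x) _)).wk _) (.var .z)))) := by
    intro V h x y k κ' hxy hk
    have e {X Y Z : C} (f : X ⊗ Y ⟶ Z) (a : W ⟶ X) (b : V ⟶ Y) :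
        lift (h ≫ a ≫ Lam f) b ≫ Ev Y Z = lift (h ≫ a) b ≫ f := by
      rw [← Category.assoc, lift_Lam_Ev]
    refine (congrArg (wpp ν · k) (e _ _ _)).trans ?_
    exact (ih V _ _ k κ' ((hγ.comp h).cons hxy) hk).trans (ap_cps_abs γ' h κ M.cps y κ').symm
  have h := hq W (𝟙 W) _ _ hx
  rw [Category.id_comp] at h
  refine Eq.trans ?_ h
  exact (congrArg (wpp ν · q) (Category.assoc _ _ _).symm).trans (wpp_unit ν _ _)

theorem TermRel.case {ρ₁ ρ₂ : Ty S.B} {M : Tm S Γ (.sum ρ₁ ρ₂)} {N₁ : Tm S (ρ₁ :: Γ) τ}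
    {N₂ : Tm S (ρ₂ :: Γ) τ} (ih : TermRel A ν M) (ih₁ : TermRel A ν N₁)
    (ih₂ : TermRel A ν N₂) : TermRel A ν (.case M N₁ N₂) := by
  intro W γ γ' q κ hγ hq
  refine Eq.trans ?_ (ap_cps_bind γ' κ _ _).symm
  have e {X Y Z : C} (m : A.ctx Γ ⟶ A.T.obj (X ⨿ Y)) (f : A.ctx Γ ⊗ X ⟶ A.T.obj Z)
      (g : A.ctx Γ ⊗ Y ⟶ A.T.obj Z) (k : W ⊗ Z ⟶ ν.A) :
      wpp ν (γ ≫ lift (𝟙 _) m ≫ A.T.str _ _ ≫ A.T.map (leftDistrib _ _ _).inv ≫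
        A.T.map (coprod.desc f g) ≫ A.T.μ.app _) k =
      wpp ν (γ ≫ m) (copair (wpp ν ((γ ▷ X) ≫ f) ((CartesianMonoidalCategory.fst W X ▷ Z) ≫ k))
        (wpp ν ((γ ▷ Y) ≫ g) ((CartesianMonoidalCategory.fst W Y ▷ Z) ≫ k))) := by
    have h := lift_str (T := A.T) (𝟙 W) (γ ≫ m) γ
    rw [Category.id_comp] at h
    rw [← Category.assoc γ, comp_lift, Category.comp_id, reassoc_of% h, ← wpp_copair, ← wpp_bind,
      ← whiskerRight_copair, copair]
    simp only [Functor.map_comp, Category.assoc]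
  refine (e _ _ _ _).trans (ih W γ γ' _ _ hγ ?_)
  intro V h x y hxy
  refine Eq.trans ?_ (ap_cps_case γ' κ h _ _ y).symm
  -- Each branch gives a related pair: the weakest precondition of the source branch and the curried
  -- target branch. The sum clause for the scrutinee is then applied to the two pairs.
  have hk {σ : Ty S.B} {N : Tm S (σ :: Γ) τ} (ihN : TermRel A ν N) :
      ContRel (LR A ν σ) ((h ▷ A.ty σ) ≫ wpp ν (X := A.ty τ) ((γ ▷ A.ty σ) ≫ A.sem N)
        ((CartesianMonoidalCategory.fst W (A.ty σ) ▷ A.ty τ) ≫ q))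
        (Lam (Y := A.tty ν σ.cps) (branch γ' κ h N.cps)) := by
    intro U g x z hxz
    refine Eq.trans ?_ ((lift_Lam_Ev _ _ _).trans (lift_branch γ' κ h N.cps g z)).symm
    have hc := hγ.comp (g ≫ h)
    rw [Category.assoc, Category.assoc] at hc
    have hq' := hq.comp (g ≫ h)
    rw [Category.assoc] at hq'
    refine Eq.trans ?_ (ihN U _ _ _ _ (hc.cons hxz) hq')
    have e' {X Z : C} (x : U ⟶ X) (f : A.ctx Γ ⊗ X ⟶ A.T.obj Z) (k : W ⊗ Z ⟶ ν.A) :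
        lift g x ≫ (h ▷ X) ≫ wpp ν ((γ ▷ X) ≫ f)
          ((CartesianMonoidalCategory.fst W X ▷ Z) ≫ k) =
        wpp ν (lift (g ≫ h ≫ γ) x ≫ f) (((g ≫ h) ▷ Z) ≫ k) := by
      rw [lift_whiskerRight_assoc, comp_wpp, lift_whiskerRight_assoc, Category.assoc,
        ← comp_whiskerRight_assoc, lift_fst]
    exact e' _ _ _
  have := hxy V (𝟙 V) _ _ _ _ (hk ih₁) (hk ih₂)
  rw [Unlam_Lam, Unlam_Lam, Category.id_comp, Category.id_comp] at this
  exact (lift_copair _ _ _ _).trans this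

theorem fundamental (M : Tm S Γ ρ) : TermRel A ν M := by
  induction M with
  | var x => exact .var x
  | const k M ih => exact ih.const k
  | op o ρ M ih => exact ih.op o
  | unit => exact .unit
  | pair M N ihM ihN => exact ihM.pair ihN
  | fst M ih => exact ih.fst
  | snd M ih => exact ih.snd
  | absurd M ih => exact ih.absurd
  | inl M ih => exact ih.inl
  | inr M ih => exact ih.inr
  | case M N₁ N₂ ih ih₁ ih₂ => exact ih.case ih₁ ih₂
  | lam M ih => exact ih.lam
  | app M N ihM ihN => exact ihM.app ihN

theorem envRel_groundCtxHom : ∀ {Γ : List (Ty S.B)} (hΓ : ∀ σ ∈ Γ, σ.IsGround) {W : C}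
    (γ : W ⟶ A.ctx Γ), EnvRel A ν γ (γ ≫ A.groundCtxHom ν hΓ)
  | [], _, _, _ => fun _ x => nomatch x
  | ρ :: Γ, hΓ, W, γ => by
    have ih := envRel_groundCtxHom (fun σ hσ => hΓ σ (List.mem_cons_of_mem ρ hσ))
      (γ ≫ fst (A.ctx Γ) (A.ty ρ))
    have := ih.cons (LR_groundHom (hΓ ρ List.mem_cons_self) (γ ≫ snd (A.ctx Γ) (A.ty ρ)))
    have e₁ : lift (γ ≫ fst (A.ctx Γ) (A.ty ρ)) (γ ≫ snd (A.ctx Γ) (A.ty ρ)) = γ :=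
      lift_comp_fst_snd _
    have e {X Y X' Y' : C} (γ : W ⟶ X ⊗ Y) (f : X ⟶ X') (g : Y ⟶ Y') :
        γ ≫ (f ⊗ₘ g) = lift ((γ ≫ fst X Y) ≫ f) ((γ ≫ snd X Y) ≫ g) := by
      ext <;> simp
    rw [groundCtxHom_cons]
    exact (congrArg₂ (EnvRel A ν) e₁ (e γ _ _).symm).mp this

end Str

end

end

end LambdaC

/-! ### The theorem for ground contexts and types -/

theorem mainTheorem1 {S : Sig.{a, b, c}} {C : Type u} [Category.{v} C] [CartesianMonoidalCategory C]
    [MonoidalClosed C] [HasInitial C] [HasBinaryCoproducts C]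
    (hcar : ∀ k : S.K, (S.carK k).IsProdGround)
    (A : Str S C) (ν : A.T.toMonad.Algebra)
    {Γ : List (Ty S.B)} {ρ : Ty S.B} (hΓ : ∀ σ ∈ Γ, σ.IsGround) (hρ : ρ.IsGround)
    (M : Tm S Γ ρ) (P : TTm S [ρ.cps] .R) :
    wp ν (A.sem M) (A.groundHom ν hρ ≫ lift (toUnit _) (𝟙 _) ≫ A.tsem ν P) =
      A.groundCtxHom ν hΓ ≫ A.tsem ν (.app M.cps (.lam (P.weakenCtx (Γ.map Ty.cps)))) := by
  rw [Str.comp_tsem_app, ← wpp_snd]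
  -- The fundamental lemma is used at the generic environment, the identity of the source context,
  -- with a postcondition that ignores its parameters.
  have hγ := Str.envRel_groundCtxHom (ν := ν) hΓ (𝟙 (A.ctx Γ))
  rw [Category.id_comp] at hγ
  refine Eq.trans ?_ (Str.fundamental M _ (𝟙 _) _ (snd (A.ctx Γ) (A.ty ρ) ≫
    A.groundHom ν hρ ≫ lift (toUnit _) (𝟙 _) ≫ A.tsem ν P) _ hγ ?_)
  · rw [Category.id_comp]
  · intro V h x y hxy
    refine Eq.trans ?_ ((congrArg (Str.ap · y) (Category.assoc _ _ _).symm).trans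
      (Str.ap_lam_weakenCtx _ P y)).symm
    have e {X Y Z : C} (z : V ⟶ X) (f : X ⟶ Y) (q : 𝟙_ C ⊗ Y ⟶ Z) :
        lift h z ≫ snd _ _ ≫ f ≫ lift (toUnit _) (𝟙 _) ≫ q = lift (toUnit V) (z ≫ f) ≫ q := by
      rw [lift_snd_assoc, ← Category.assoc, ← Category.assoc, comp_lift, comp_toUnit,
        Category.comp_id]
    -- The postcondition and `λ x. P` are related because `P` is a test whose parameter object is
    -- the empty context.
    have := ((Str.LR_iff_omegaEq hρ).1 hxy).test (𝟙 V) (toUnit V) (A.tsem ν P)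
    rw [Category.id_comp, Category.id_comp] at this
    exact (e _ _ _).trans this
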